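/- Let $m,n,p$ be natural numbers. For $i=1,\dots,m$ let $A_i\in\mathbb{R}^{n\times n}$, $B_i\in\mathbb{R}^{n\times 1}$, $C_i\in\mathbb{R}^{1\times n}$ and $k_{p_i}\in\mathbb{R}\setminus\{0\}$, and put $\mathbf{A}=\mathrm{diag}\{A_1,\dots,A_m\}$, $\mathbf{B}=\mathrm{diag}\{B_1,\dots,B_m\}$, $\mathbf{C}=\mathrm{diag}\{C_1,\dots,C_m\}$ (block diagonal) and $\mathbf{k}_p=\mathrm{diag}\{k_{p_1},\dots,k_{p_m}\}$. Consider the undisturbed network $$\dot{\bar x}(t)=\mathbf{A}\bar x(t)+\mathbf{B}\bar u(t),\qquad \bar y(t)=\mathbf{k}_p\mathbf{C}\bar x(t),\qquad \bar x\in\mathbb{R}^{nm}.$$ Assume that $(\mathbf{A},\mathbf{B})$ is stabilizable, that $(\mathbf{A},\mathbf{C})$ is detectable, that no diagonal entry $C_i(sI_n-A_i)^{-1}B_i$ of the transfer function $\mathbf{W}_\beta(s)=\mathbf{C}(sI_{nm}-\mathbf{A})^{-1}\mathbf{B}$ vanishes identically, and that $\mathbf{W}_\beta$ is strictly positive real,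 i.e. for some $\varepsilon>0$ the function $s\mapsto \mathbf{W}_\beta(s-\varepsilon)$ is positive real: analytic in $\mathrm{Re}\,s>0$ (up to removable singularities), real for real $s>0$, and with positive semidefinite Hermitian part for $\mathrm{Re}\,s>0$. For a signal $\bar\eta=[\eta_1^\top,\dots,\eta_m^\top]^\top$ with $\eta_i:\mathbb{R}^+\to\mathbb{R}^p$, use the controller $\bar u(t)=\Theta^\top(t)\bar\eta(t)$ with $\Theta(t)\in\mathbb{R}^{pm\times m}$ adapted by $$\dot\Theta^\top(t)=-\mathrm{sign}(\mathbf{k}_p)\,\bar y(t)\,\bar\eta^\top(t).$$ Then, for every $\bar\eta$, $(\bar x,\Theta)=0$ is an equilibrium of the closed loop and is uniformly stable in the large, with bounds that do not depend on $\bar\eta$: for every $\epsilon>0$ there is $\delta>0$, and for every $r>0$ there is $R>0$, such that for all $\bar\eta$, all $0\le t_0\le t_1$ and every (absolutely continuous, almost everywhere) solution $(\bar x,\Theta)$ on $[t_0,t_1]$, $\|(\bar x(t_0),\Theta(t_0))\|<\delta$ implies $\|(\bar x(t),\Theta(t))\|<\epsilon$ on $[t_0,t_1]$, and $\|(\bar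 x(t_0),\Theta(t_0))\|<r$ implies $\|(\bar x(t),\Theta(t))\|<R$ on $[t_0,t_1]$. -/

import Mathlib

open Matrix Set MeasureTheory
open scoped ComplexOrder

noncomputable section

namespace NetAdapt

/-! ### Linear systems theory -/

section Linear

variable {ι κ : Type*} [Fintype ι] [DecidableEq ι] [Fintype κ] [DecidableEq κ]

/-- A real square matrix all of whose complex eigenvalues lie in the open left half-plane. -/
def IsHurwitz (M : Matrix ι ι ℝ) : Prop :=
  ∀ z ∈ spectrum ℂ (M.map (algebraMap ℝ ℂ)), z.re < 0

/-- `(A, B)` is stabilizable: some state feedback `u = K x` makes `A + B K` Hurwitz. -/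
def IsStabilizable (A : Matrix ι ι ℝ) (B : Matrix ι κ ℝ) : Prop :=
  ∃ K : Matrix κ ι ℝ, IsHurwitz (A + B * K)

/-- `(A, C)` is detectable: some output injection makes `A + L C` Hurwitz. -/
def IsDetectable (A : Matrix ι ι ℝ) (C : Matrix κ ι ℝ) : Prop :=
  ∃ L : Matrix ι κ ℝ, IsHurwitz (A + L * C)

/-- The transfer function `s ↦ C (s I - A)⁻¹ B`; its values at the finitely many eigenvalues
of `A` carry no meaning. -/
def transferFunction (A : Matrix ι ι ℝ) (B : Matrix ι κ ℝ) (C : Matrix κ ι ℝ) (s : ℂ) :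
    Matrix κ κ ℂ :=
  C.map (algebraMap ℝ ℂ) * (s • (1 : Matrix ι ι ℂ) - A.map (algebraMap ℝ ℂ))⁻¹ *
    B.map (algebraMap ℝ ℂ)

/-- Positive realness of a rational matrix function `W`: its entries are analytic for `re s > 0`,
they are real at real points, and `W(s) + W(s)ᴴ` is positive semidefinite for `re s > 0`.
Here `G` is `W` with its finitely many removable singularities removed, so that cancelled poles,
and the arbitrary values of the matrix inverse there, do not matter. -/
def IsPositiveReal (W : ℂ → Matrix κ κ ℂ) : Prop :=
  ∃ G : ℂ → Matrix κ κ ℂ,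
    (∃ S : Set ℂ, S.Finite ∧ ∀ s : ℂ, 0 < s.re → s ∉ S → G s = W s) ∧
    (∀ i j, DifferentiableOn ℂ (fun s => G s i j) {s : ℂ | 0 < s.re}) ∧
    (∀ x : ℝ, 0 < x → ∀ i j, (G (x : ℂ) i j).im = 0) ∧
    (∀ s : ℂ, 0 < s.re → (G s + (G s)ᴴ).PosSemidef)

/-- Strict positive realness: `s ↦ W(s - ε)` is positive real for some `ε > 0`. -/
def IsStrictlyPositiveReal (W : ℂ → Matrix κ κ ℂ) : Prop :=
  ∃ ε : ℝ, 0 < ε ∧ IsPositiveReal (fun s => W (s - (ε : ℂ)))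

end Linear

/-! ### Stability of an equilibrium at the origin -/

section Stability

variable {E : Type*} [NormedAddCommGroup E] [NormedSpace ℝ E]

/-- `z` is a (Carathéodory) solution of `ż = f(t, z)` on `[t₀, t₁]`: it is absolutely continuous
there and satisfies the equation almost everywhere. -/
def IsSolution (f : ℝ → E → E) (t₀ t₁ : ℝ) (z : ℝ → E) : Prop :=
  AbsolutelyContinuousOnInterval z t₀ t₁ ∧
    ∀ᵐ t : ℝ, t ∈ Ioo t₀ t₁ → HasDerivAt z (f t (z t)) t

/-- The origin is an equilibrium of every system `ż = f i (t, z)`, `t ≥ 0`, of a family, and it is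
uniformly stable in the large: it is uniformly stable, and the solutions are uniformly bounded,
for arbitrarily large initial states. The bounds depend neither on the initial time
nor on the member `i` of the family; for a single system (a one-point index type) this is the
classical notion. Solutions on all compact intervals `[t₀, t₁]` are considered, so that nothing is
presupposed about their continuation. In finite dimensions the choice of the norm is immaterial. -/
def UniformlyStableInTheLarge {I : Type*} (f : I → ℝ → E → E) : Prop :=
  (∀ i, ∀ t : ℝ, 0 ≤ t → f i t 0 = 0) ∧
  (∀ ε : ℝ, 0 < ε → ∃ δ : ℝ, 0 < δ ∧
    ∀ (i : I) (t₀ t₁ : ℝ) (z : ℝ → E), 0 ≤ t₀ → t₀ ≤ t₁ → IsSolution (f i) t₀ t₁ z →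
      ‖z t₀‖ < δ → ∀ t ∈ Icc t₀ t₁, ‖z t‖ < ε) ∧
  (∀ r : ℝ, 0 < r → ∃ R : ℝ, 0 < R ∧
    ∀ (i : I) (t₀ t₁ : ℝ) (z : ℝ → E), 0 ≤ t₀ → t₀ ≤ t₁ → IsSolution (f i) t₀ t₁ z →
      ‖z t₀‖ < r → ∀ t ∈ Icc t₀ t₁, ‖z t‖ < R)

end Stability

/-! ### The networked system

There are `m` agents with `n` states, one input and one output each. The pair `(a, i)` indexes
the `a`-th coordinate of agent `i`. -/

section Network

variable {m n p : ℕ}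

/-- `diag{A₁, …, Aₘ}`. -/
def netA (A : Fin m → Matrix (Fin n) (Fin n) ℝ) : Matrix (Fin n × Fin m) (Fin n × Fin m) ℝ :=
  Matrix.blockDiagonal A

/-- `diag{B₁, …, Bₘ}` with columns `Bᵢ`. -/
def netB (B : Fin m → Fin n → ℝ) : Matrix (Fin n × Fin m) (Fin m) ℝ :=
  Matrix.of fun q j => if q.2 = j then B j q.1 else 0

/-- `diag{C₁, …, Cₘ}` with rows `Cᵢ`. -/
def netC (C : Fin m → Fin n → ℝ) : Matrix (Fin m) (Fin n × Fin m) ℝ :=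
  Matrix.of fun i q => if q.2 = i then C i q.1 else 0

/-- The pairs `(x̄, Θ)` of a network state and a parameter matrix `Θ ∈ ℝ^{(p m) × m}`. -/
abbrev State (m n p : ℕ) : Type :=
  (Fin n × Fin m → ℝ) × (Fin p × Fin m → Fin m → ℝ)

/-- The output `ȳ = k_p C x̄`, with `k_p = diag{k₁, …, kₘ}`. -/
def output (C : Fin m → Fin n → ℝ) (k : Fin m → ℝ) (x : Fin n × Fin m → ℝ) : Fin m → ℝ :=
  (Matrix.diagonal k * netC C) *ᵥ x

/-- The controller `ū = Θᵀ η̄`. -/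
def feedbackInput (Θ : Matrix (Fin p × Fin m) (Fin m) ℝ) (η : Fin p × Fin m → ℝ) : Fin m → ℝ :=
  Θᵀ *ᵥ η

/-- The right-hand side `Θ̇`, where `Θ̇ᵀ = - sign(k_p) ȳ η̄ᵀ`. -/
def adaptiveLaw (k y : Fin m → ℝ) (η : Fin p × Fin m → ℝ) :
    Matrix (Fin p × Fin m) (Fin m) ℝ :=
  (-(Matrix.diagonal (fun i => Real.sign (k i)) * Matrix.vecMulVec y η))ᵀ

/-- The undisturbed closed loop `d/dt (x̄, Θ) = (A x̄ + B Θᵀ η̄(t), - (sign(k_p) ȳ η̄(t)ᵀ)ᵀ)`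
driven by the signal `η̄`. -/
def closedLoop (A : Fin m → Matrix (Fin n) (Fin n) ℝ) (B C : Fin m → Fin n → ℝ) (k : Fin m → ℝ)
    (η : ℝ → Fin p × Fin m → ℝ) (t : ℝ) (z : State m n p) : State m n p :=
  (netA A *ᵥ z.1 + netB B *ᵥ feedbackInput (Matrix.of z.2) (η t),
    adaptiveLaw k (output C k z.1) (η t))

end Network

end NetAdapt

end

noncomputable section

namespace NetAdapt

/-! ### Unitary operators and skew-Hermitian pairs -/

section Unitary

open Module.End LinearMap

/-! The Lyapunov function is V = x̄ᵀ P x̄ + Σ_j |k_j|⁻¹ ‖Θ_j‖², with Θ_j the columns of Θ. If P is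
symmetric positive definite with x̄ᵀ P A x̄ ≤ 0 and P B = Cᵀ, then the coupling 2 (C x̄)ᵀ ū cancels
the derivative of the parameter term, because sign(k_j) k_j = |k_j|. Hence V̇ = 2 x̄ᵀ P A x̄ ≤ 0
whatever η̄ is, and comparing V with the squared norm gives bounds free of η̄
(`uniformlyStableInTheLarge_of_quadratic`).

P comes from a Kalman–Yakubovich–Popov argument that does not need minimality. Stabilizability and
detectability make every eigenvalue of A in the closed right half-plane visible as a singularity of
the transfer function, so A is Hurwitz (`isHurwitz_of_isStrictlyPositiveReal`). Each diagonal entry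
of the transfer function is scalar, nonzero, and has nonnegative real part on re s > -ε;
`exists_kyp` turns it into P_i > 0 with P_i b_i = c_i. The block projections E_i commute with A, so
Σ E_i P_i E_i serves all agents (`exists_network_storage`).

The scalar inequality is proved by convex duality (`exists_symmetric_kyp`): if it had no solution,
Hahn–Banach would give a nonzero positive semidefinite multiplier Z with nonnegative dual value.
`dual_value_neg` refutes this by splitting Z into pieces, each belonging to one frequency ω or to
the direction b. Positivity of the real part on the imaginary axis (open mapping, `transfer_re_pos`)
handles the former; c·b > 0 and c·Ab < 0, read off from the behaviour at infinity
(`highFrequencyGain_pos`, `second_markov_neg`), handle the latter. -/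

/-- Two commuting symmetric operators have a joint orthonormal eigenbasis. -/
theorem exists_orthonormalBasis_joint_eigenvector {E : Type*} [NormedAddCommGroup E]
    [InnerProductSpace ℂ E] [FiniteDimensional ℂ E] {A B : E →ₗ[ℂ] E} (hA : A.IsSymmetric)
    (hB : B.IsSymmetric) (hAB : Commute A B) {n : ℕ} (hn : Module.finrank ℂ E = n) :
    ∃ b : OrthonormalBasis (Fin n) ℂ E,
      ∀ i, ∃ α β : ℂ, A (b i) = α • b i ∧ B (b i) = β • b i := by
  classical
  have := (finite_hasEigenvalue A).fintype
  have := (finite_hasEigenvalue B).fintype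
  -- Indexing by genuine eigenvalues keeps the family finite; the eigenspaces left out are zero.
  let F : {β | HasEigenvalue B β} × {α | HasEigenvalue A α} → Submodule ℂ E :=
    fun i => eigenspace A i.2.1 ⊓ eigenspace B i.1.1
  have hinj : Function.Injective
      (fun i : {β | HasEigenvalue B β} × {α | HasEigenvalue A α} => (i.1.1, i.2.1)) := by
    intro i j h
    exact Prod.ext (Subtype.ext (congrArg Prod.fst h)) (Subtype.ext (congrArg Prod.snd h))
  have hfam : OrthogonalFamily ℂ (fun i => F i) fun i => (F i).subtypeₗᵢ := by
    refine OrthogonalFamily.of_pairwise fun i j hij v hv w hw => ?_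
    exact (hA.orthogonalFamily_eigenspace_inf_eigenspace hB).pairwise (hinj.ne hij) hv w hw
  have htop : (⨆ i, F i) = ⊤ := by
    rw [eq_top_iff, ← hA.iSup_iSup_eigenspace_inf_eigenspace_eq_top_of_commute hB hAB]
    refine iSup_le fun α => iSup_le fun γ => ?_
    by_cases h1 : eigenspace A α = ⊥
    · simp [h1]
    by_cases h2 : eigenspace B γ = ⊥
    · simp [h2]
    exact le_iSup F (⟨γ, h2⟩, ⟨α, h1⟩)
  have hint : DirectSum.IsInternal F := by
    rw [hfam.isInternal_iff, htop, Submodule.top_orthogonal_eq_bot]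
  refine ⟨hint.subordinateOrthonormalBasis hn hfam, fun i => ?_⟩
  obtain ⟨h1, h2⟩ := hint.subordinateOrthonormalBasis_subordinate hn i hfam
  exact ⟨_, _, mem_eigenspace_iff.1 h1, mem_eigenspace_iff.1 h2⟩

/-- An isometry of a finite-dimensional complex inner product space is diagonalised by an
orthonormal basis. -/
theorem exists_orthonormalBasis_eigenvector {E : Type*} [NormedAddCommGroup E]
    [InnerProductSpace ℂ E] [FiniteDimensional ℂ E] (V : E →ₗᵢ[ℂ] E) :
    ∃ b : OrthonormalBasis (Fin (Module.finrank ℂ E)) ℂ E, ∀ i, ∃ μ : ℂ, V (b i) = μ • b i := by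
  set T : E →ₗ[ℂ] E := V.toLinearMap with hT
  set S : E →ₗ[ℂ] E := LinearMap.adjoint T with hS
  have hST : S ∘ₗ T = LinearMap.id := by
    ext x
    refine ext_inner_right ℂ fun y => ?_
    simp [hS, hT]
  have hTS : T ∘ₗ S = LinearMap.id := (LinearMap.comp_eq_id_comm ℂ E).1 hST
  -- T is unitary, so it commutes with its adjoint S, and 2T = (T + S) - i · (i(T - S)) is a
  -- combination of two commuting symmetric operators.
  have hA : (T + S).IsSymmetric := by
    intro x y
    simp only [LinearMap.add_apply, inner_add_left, inner_add_right, hS,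
      LinearMap.adjoint_inner_left, LinearMap.adjoint_inner_right, add_comm]
  have hB : (Complex.I • (T - S)).IsSymmetric := by
    intro x y
    simp only [LinearMap.smul_apply, LinearMap.sub_apply, inner_smul_left, inner_smul_right,
      inner_sub_left, inner_sub_right, hS, LinearMap.adjoint_inner_left,
      LinearMap.adjoint_inner_right, Complex.conj_I]
    ring
  have hAB : Commute (T + S) (Complex.I • (T - S)) := by
    have h : Commute T S := by
      change T ∘ₗ S = S ∘ₗ T
      rw [hST, hTS]
    exact (((Commute.refl T).sub_right h).add_left (h.symm.sub_right (Commute.refl S))).smul_right _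
  obtain ⟨b, hb⟩ := exists_orthonormalBasis_joint_eigenvector hA hB hAB rfl
  refine ⟨b, fun i => ?_⟩
  obtain ⟨α, β, h1, h2⟩ := hb i
  refine ⟨(α - Complex.I * β) / 2, ?_⟩
  have h3 : Complex.I • (Complex.I • (T - S)) (b i) = -(T (b i) - S (b i)) := by
    simp [smul_smul]
  rw [h2] at h3
  have h4 : (2 : ℂ) • T (b i) = (α - Complex.I * β) • b i := by
    rw [sub_smul, mul_smul, h3, ← h1]
    simp only [LinearMap.add_apply]
    module
  have h5 : V (b i) = T (b i) := rfl
  rw [h5, div_eq_inv_mul, mul_smul, ← h4, smul_smul]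
  simp

/-- If `G Hᴴ` is skew-Hermitian, then there is an orthonormal basis of vectors `q` such that
`H q = 0` or `G q = i ω H q` with `ω` real. -/
theorem exists_orthonormalBasis_of_skew {E F : Type*} [NormedAddCommGroup E]
    [InnerProductSpace ℂ E] [FiniteDimensional ℂ E] [NormedAddCommGroup F]
    [InnerProductSpace ℂ F] [FiniteDimensional ℂ F] (G H : E →ₗ[ℂ] F)
    (h : G ∘ₗ LinearMap.adjoint H + H ∘ₗ LinearMap.adjoint G = 0) :
    ∃ b : OrthonormalBasis (Fin (Module.finrank ℂ E)) ℂ E, ∀ i,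
      H (b i) = 0 ∨ ∃ ω : ℝ, G (b i) = ((ω : ℂ) * Complex.I) • H (b i) := by
  -- The hypothesis is equivalent to (G + H)(G + H)* = (G - H)(G - H)*.
  have hnorm : ∀ v, ‖LinearMap.adjoint (G + H) v‖ = ‖LinearMap.adjoint (G - H) v‖ := by
    intro v
    have h1 : inner ℂ (LinearMap.adjoint (G + H) v) (LinearMap.adjoint (G + H) v) =
        inner ℂ (LinearMap.adjoint (G - H) v) (LinearMap.adjoint (G - H) v) := by
      have h2 : inner ℂ v ((G ∘ₗ LinearMap.adjoint H + H ∘ₗ LinearMap.adjoint G) v) = 0 := by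
        rw [h]; simp
      rw [LinearMap.adjoint_inner_left, LinearMap.adjoint_inner_left]
      simp only [map_add, map_sub, LinearMap.add_apply, LinearMap.sub_apply, LinearMap.comp_apply,
        inner_add_right, inner_sub_right] at h2 ⊢
      linear_combination 2 * h2
    rw [inner_self_eq_norm_sq_to_K, inner_self_eq_norm_sq_to_K] at h1
    have h3 : ‖LinearMap.adjoint (G + H) v‖ ^ 2 = ‖LinearMap.adjoint (G - H) v‖ ^ 2 := by
      exact_mod_cast h1
    exact (sq_eq_sq₀ (norm_nonneg _) (norm_nonneg _)).1 h3
  set Y := LinearMap.adjoint (G - H)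
  set X := LinearMap.adjoint (G + H)
  -- By `hnorm`, Y v ↦ X v is a well-defined isometry on the range of Y; it extends to the whole
  -- space and can then be diagonalised.
  obtain ⟨r, hr⟩ := Y.rangeRestrict.exists_rightInverse_of_surjective Y.range_rangeRestrict
  have hXr : ∀ v, X (r (Y.rangeRestrict v)) = X v := by
    intro v
    have h1 : Y (r (Y.rangeRestrict v) - v) = 0 := by
      have := congrArg Subtype.val (LinearMap.congr_fun hr (Y.rangeRestrict v))
      rw [map_sub, sub_eq_zero]
      exact this
    rw [← sub_eq_zero, ← map_sub, ← norm_eq_zero, hnorm, h1, norm_zero]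
  let L : LinearMap.range Y →ₗᵢ[ℂ] E :=
    { toLinearMap := X ∘ₗ r
      norm_map' := by
        rintro ⟨_, v, rfl⟩
        exact (congrArg norm (hXr v)).trans (hnorm v) }
  set U := L.extend
  have hU : ∀ v, U (Y v) = X v := fun v =>
    (L.extend_apply ⟨Y v, LinearMap.mem_range_self _ v⟩).trans (hXr v)
  obtain ⟨b, hb⟩ := exists_orthonormalBasis_eigenvector U
  refine ⟨b, fun i => ?_⟩
  obtain ⟨μ, hμ⟩ := hb i
  have hμ1 : ‖μ‖ = 1 := by
    have := U.norm_map (b i)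
    rwa [hμ, norm_smul, b.norm_eq_one, mul_one] at this
  have hμ0 : μ ≠ 0 := by
    rintro rfl
    simp at hμ1
  -- `μ (G + H) b = (G - H) b`
  have key : μ • (G + H) (b i) = (G - H) (b i) := by
    refine ext_inner_left ℂ fun v => ?_
    rw [inner_smul_right, ← LinearMap.adjoint_inner_left, ← LinearMap.adjoint_inner_left, ← hU,
      ← U.inner_map_map (LinearMap.adjoint (G - H) v) (b i), hμ, inner_smul_right]
  have key' : (1 - μ) • G (b i) = (1 + μ) • H (b i) := by
    simp only [LinearMap.add_apply, LinearMap.sub_apply, smul_add] at key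
    rw [sub_smul, add_smul, one_smul, one_smul]
    have h2 := sub_eq_zero.2 key
    rw [← sub_eq_zero, ← neg_eq_zero, ← h2]
    abel
  by_cases h1 : μ = 1
  · left
    rw [h1] at key'
    norm_num at key'
    simpa using key'.symm
  · right
    have h2 : 1 - μ ≠ 0 := sub_ne_zero.2 (Ne.symm h1)
    -- The Cayley transform of a unimodular μ ≠ 1 is purely imaginary.
    have hre : ((1 + μ) / (1 - μ)).re = 0 := by
      have hsq : μ.re * μ.re + μ.im * μ.im = 1 := by
        rw [← Complex.normSq_apply, Complex.normSq_eq_norm_sq, hμ1]; norm_num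
      rw [Complex.div_re, ← add_div]
      rw [div_eq_zero_iff]
      left
      simp
      linarith
    refine ⟨((1 + μ) / (1 - μ)).im, ?_⟩
    have h3 : ((((1 + μ) / (1 - μ)).im : ℂ) * Complex.I) = (1 + μ) / (1 - μ) := by
      apply Complex.ext <;> simp [hre]
    rw [h3, div_eq_inv_mul, mul_smul, ← key', smul_smul, inv_mul_cancel₀ h2, one_smul]

end Unitary

/-! ### The dual certificate of the Kalman–Yakubovich–Popov inequality -/

section Dual

/-- A real matrix viewed as a complex one. -/
abbrev complexMatrix {ι κ : Type*} (M : Matrix ι κ ℝ) : Matrix ι κ ℂ := M.map (algebraMap ℝ ℂ)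

/-- A real vector viewed as a complex one. -/
abbrev complexVector {ι : Type*} (v : ι → ℝ) : ι → ℂ := algebraMap ℝ ℂ ∘ v

theorem complexMatrix_mulVec {ι κ : Type*} [Fintype ι] (M : Matrix κ ι ℝ) (v : ι → ℝ) :
    complexMatrix M *ᵥ complexVector v = complexVector (M *ᵥ v) := by
  ext i
  exact (RingHom.map_mulVec (algebraMap ℝ ℂ) M v i).symm

theorem complexMatrix_mul {ι κ τ : Type*} [Fintype ι] (M : Matrix κ ι ℝ) (N : Matrix ι τ ℝ) :
    complexMatrix (M * N) = complexMatrix M * complexMatrix N :=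
  Matrix.map_mul

theorem complexVector_dotProduct {ι : Type*} [Fintype ι] (v w : ι → ℝ) :
    complexVector v ⬝ᵥ complexVector w = ((v ⬝ᵥ w : ℝ) : ℂ) :=
  (RingHom.map_dotProduct (algebraMap ℝ ℂ) v w).symm

theorem star_complexVector {ι : Type*} (v : ι → ℝ) : star (complexVector v) = complexVector v := by
  ext i; simp

theorem complexMatrix_conjTranspose {ι κ : Type*} (M : Matrix κ ι ℝ) :
    (complexMatrix M)ᴴ = complexMatrix Mᵀ := by
  ext i j; simp

/-- If `G Hᴴ` is skew-Hermitian, then there is a resolution of the identity into vectors `q`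
with `H q = 0` or `G q = i ω H q` with `ω` real. -/
theorem exists_resolution_of_skew {ι κ : Type*} [Fintype ι] [DecidableEq ι] [Fintype κ]
    [DecidableEq κ] (G H : Matrix ι κ ℂ) (h : G * Hᴴ + H * Gᴴ = 0) :
    ∃ (N : ℕ) (q : Fin N → κ → ℂ),
      (∀ a c : κ → ℂ, ∑ j, (a ⬝ᵥ q j) * (star (q j) ⬝ᵥ c) = a ⬝ᵥ c) ∧
      ∀ j, H *ᵥ q j = 0 ∨ ∃ ω : ℝ, G *ᵥ q j = ((ω : ℂ) * Complex.I) • (H *ᵥ q j) := by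
  obtain ⟨b, hb⟩ := exists_orthonormalBasis_of_skew (toEuclideanLin G) (toEuclideanLin H) (by
    rw [← toEuclideanLin_conjTranspose_eq_adjoint, ← toEuclideanLin_conjTranspose_eq_adjoint]
    ext v i
    have := congrFun (congrArg (· *ᵥ WithLp.ofLp v) h) i
    simpa [Matrix.add_mulVec, ← Matrix.mulVec_mulVec, toLpLin_apply] using this)
  refine ⟨_, fun j => WithLp.ofLp (b j), fun a c => ?_, fun j => ?_⟩
  · have := b.sum_inner_mul_inner (WithLp.toLp 2 (star a)) (WithLp.toLp 2 c)
    simpa [EuclideanSpace.inner_eq_star_dotProduct, dotProduct_comm] using this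
  · refine (hb j).imp (fun h => ?_) (fun ⟨ω, h⟩ => ⟨ω, ?_⟩)
    · exact congrArg WithLp.ofLp h
    · exact congrArg WithLp.ofLp h

open scoped MatrixOrder Matrix.Norms.L2Operator in
theorem exists_eq_conjTranspose_mul_self {ι : Type*} [Fintype ι] [DecidableEq ι]
    {Z : Matrix ι ι ℝ} (hZ : Z.PosSemidef) : ∃ Y : Matrix ι ι ℝ, Z = Yᴴ * Y :=
  CStarAlgebra.nonneg_iff_eq_star_mul_self.1 hZ.nonneg

/-- The value of the dual functional on a nonzero matrix `Z` that is feasible for the dual of the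
Kalman–Yakubovich–Popov problem is negative. -/
theorem dual_value_neg {ι : Type*} [Fintype ι] [DecidableEq ι] (A Z : Matrix ι ι ℝ)
    (b c : ι → ℝ) (h0 : 0 < c ⬝ᵥ b) (h1 : c ⬝ᵥ A *ᵥ b < 0)
    (hw : ∀ (ω : ℝ) (x : ι → ℂ) (u : ℂ),
      complexMatrix A *ᵥ x + u • complexVector b = ((ω : ℂ) * Complex.I) • x → x ≠ 0 →
        0 < (star u * (complexVector c ⬝ᵥ x)).re)
    (hZ : Z.PosSemidef) (hZ0 : Z ≠ 0)
    (hQ : (1 - (c ⬝ᵥ b)⁻¹ • vecMulVec b c) * (A * Z + Z * Aᵀ) *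
      (1 - (c ⬝ᵥ b)⁻¹ • vecMulVec b c)ᵀ = 0) :
    c ⬝ᵥ (A * Z) *ᵥ c < 0 := by
  obtain ⟨Y, hY⟩ := exists_eq_conjTranspose_mul_self hZ
  -- Q is the oblique projection onto the kernel of c along b.
  set Q : Matrix ι ι ℝ := 1 - (c ⬝ᵥ b)⁻¹ • vecMulVec b c with hQdef
  set X : Matrix ι ι ℝ := Yᵀ with hX
  have hZX : Z = X * Xᵀ := by
    rw [hY, hX, conjTranspose_eq_transpose_of_trivial, transpose_transpose]
  have hQy : ∀ y : ι → ℂ, complexMatrix Q *ᵥ y =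
      y - (((c ⬝ᵥ b : ℝ) : ℂ)⁻¹ * (complexVector c ⬝ᵥ y)) • complexVector b := by
    intro y
    have : complexMatrix Q =
        1 - ((c ⬝ᵥ b : ℝ) : ℂ)⁻¹ • vecMulVec (complexVector b) (complexVector c) := by
      ext i j
      simp [hQdef, vecMulVec_apply, Matrix.one_apply]
      split_ifs <;> simp
    rw [this, sub_mulVec, one_mulVec, smul_mulVec, vecMulVec_mulVec, mul_smul]
    congr 2
    ext i
    simp [mul_comm]
  -- With Z = X Xᵀ, `hQ` says that (QAX)(QX)ᵀ is skew-symmetric.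
  obtain ⟨N, q, hq, hGH⟩ := exists_resolution_of_skew (complexMatrix (Q * A * X))
    (complexMatrix (Q * X)) (by
      rw [complexMatrix_conjTranspose, complexMatrix_conjTranspose, ← complexMatrix_mul,
        ← complexMatrix_mul, ← Matrix.map_add _ (map_add _)]
      have : Q * A * X * (Q * X)ᵀ + Q * X * (Q * A * X)ᵀ = 0 := by
        rw [← hQ, hZX]
        simp only [transpose_mul]
        noncomm_ring
      rw [this]
      ext i j; simp)
  -- The resolution of the identity, inserted between X and Xᵀ, splits the dual value into
  -- contributions of the vectors x = X q_j.
  have hval : ∑ j, (complexVector c ⬝ᵥ complexMatrix A *ᵥ complexMatrix X *ᵥ q j) *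
      star (complexVector c ⬝ᵥ complexMatrix X *ᵥ q j) = ((c ⬝ᵥ (A * Z) *ᵥ c : ℝ) : ℂ) := by
    have h := hq (complexVector c ᵥ* (complexMatrix A * complexMatrix X))
      ((complexMatrix X)ᴴ *ᵥ complexVector c)
    rw [← dotProduct_mulVec, ← complexMatrix_mul, complexMatrix_conjTranspose, complexMatrix_mulVec,
      complexMatrix_mulVec, complexVector_dotProduct, mulVec_mulVec, Matrix.mul_assoc,
      ← hZX] at h
    rw [← h]
    refine Finset.sum_congr rfl fun j _ => ?_
    rw [← dotProduct_mulVec, mulVec_mulVec, complexMatrix_mul]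
    congr 1
    rw [dotProduct_mulVec, ← mulVec_transpose, ← star_complexVector (Xᵀ *ᵥ c),
      star_dotProduct_star, ← complexMatrix_mulVec, ← transpose_map]
  have hterm : ∀ j, complexMatrix X *ᵥ q j ≠ 0 →
      ((complexVector c ⬝ᵥ complexMatrix A *ᵥ complexMatrix X *ᵥ q j) *
      star (complexVector c ⬝ᵥ complexMatrix X *ᵥ q j)).re < 0 := by
    intro j hxj
    have hj := hGH j
    rw [complexMatrix_mul, complexMatrix_mul, complexMatrix_mul, ← mulVec_mulVec, ← mulVec_mulVec,
      ← mulVec_mulVec] at hj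
    set x := complexMatrix X *ᵥ q j
    rcases hj with hj | ⟨ω, hj⟩
    -- Here x = u b, and the contribution is |u|² (c·Ab)(c·b).
    · rw [hQy, sub_eq_zero] at hj
      set u := ((c ⬝ᵥ b : ℝ) : ℂ)⁻¹ * (complexVector c ⬝ᵥ x)
      have hu : u ≠ 0 := by
        intro hu
        rw [hu, zero_smul] at hj
        exact hxj hj
      rw [hj, mulVec_smul, dotProduct_smul, dotProduct_smul, complexMatrix_mulVec,
        complexVector_dotProduct, complexVector_dotProduct]
      have : ((u • ((c ⬝ᵥ A *ᵥ b : ℝ) : ℂ)) * star (u • ((c ⬝ᵥ b : ℝ) : ℂ))) =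
          ((Complex.normSq u * ((c ⬝ᵥ A *ᵥ b) * (c ⬝ᵥ b)) : ℝ) : ℂ) := by
        simp only [smul_eq_mul, star_mul', Complex.star_def, Complex.conj_ofReal]
        push_cast
        rw [← Complex.mul_conj]
        ring
      rw [this, Complex.ofReal_re]
      exact mul_neg_of_pos_of_neg (Complex.normSq_pos.2 hu) (mul_neg_of_neg_of_pos h1 h0)
    -- Here A x = iωx + v b, so the input -v sustains x at frequency ω. The term iω|c·x|² is
    -- imaginary and drops out of the real part.
    · rw [← sub_eq_zero, ← mulVec_smul, ← mulVec_sub, hQy, sub_eq_zero] at hj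
      set v := ((c ⬝ᵥ b : ℝ) : ℂ)⁻¹ *
        (complexVector c ⬝ᵥ (complexMatrix A *ᵥ x - ((ω : ℂ) * Complex.I) • x))
      have hA : complexMatrix A *ᵥ x = ((ω : ℂ) * Complex.I) • x + v • complexVector b := by
        rw [← hj]; abel
      have hpos := hw ω x (-v) (by rw [hA, neg_smul]; abel) hxj
      rw [hA, dotProduct_add, dotProduct_smul, dotProduct_smul, complexVector_dotProduct]
      set y := complexVector c ⬝ᵥ x
      simp at hpos ⊢
      nlinarith
  have hex : ∃ j, complexMatrix X *ᵥ q j ≠ 0 := by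
    by_contra! hall
    apply hZ0
    have hX0 : X = 0 := by
      ext i k
      have h := hq (complexMatrix X i) (Pi.single k 1)
      have h2 : ∀ j, complexMatrix X i ⬝ᵥ q j = 0 := fun j => congrFun (hall j) i
      simp only [h2, zero_mul, Finset.sum_const_zero, dotProduct_single, mul_one] at h
      simpa using h.symm
    rw [hZX, hX0, Matrix.zero_mul]
  have hre := congrArg Complex.re hval
  rw [Complex.ofReal_re, Complex.re_sum] at hre
  rw [← hre]
  obtain ⟨j, hj⟩ := hex
  refine Finset.sum_neg' (fun i _ => ?_) ⟨j, Finset.mem_univ _, hterm j hj⟩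
  by_cases hi : complexMatrix X *ᵥ q i = 0
  · simp [hi]
  · exact (hterm i hi).le

end Dual

/-! ### The Kalman–Yakubovich–Popov inequality -/

section KYP

open Filter Topology

/-- The matrices with negative definite quadratic form. -/
def negativeForms (ι : Type*) [Fintype ι] : Set (Matrix ι ι ℝ) :=
  {M | ∀ x : ι → ℝ, x ≠ 0 → x ⬝ᵥ M *ᵥ x < 0}

theorem convex_negativeForms (ι : Type*) [Fintype ι] : Convex ℝ (negativeForms ι) := by
  refine convex_iff_forall_pos.2 fun M hM N hN a b ha hb _ x hx => ?_
  rw [add_mulVec, dotProduct_add, smul_mulVec, smul_mulVec, dotProduct_smul, dotProduct_smul]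
  have h1 := mul_pos_of_neg_of_neg (hM x hx) (neg_lt_zero.2 ha)
  have h2 := mul_pos_of_neg_of_neg (hN x hx) (neg_lt_zero.2 hb)
  simp only [smul_eq_mul]
  nlinarith

/-- The complement is the image of a closed set under projection along the compact unit sphere,
hence closed. -/
theorem isOpen_negativeForms (ι : Type*) [Fintype ι] : IsOpen (negativeForms ι) := by
  have hcl : IsClosed {p : Metric.sphere (0 : ι → ℝ) 1 × Matrix ι ι ℝ |
      0 ≤ (p.1 : ι → ℝ) ⬝ᵥ p.2 *ᵥ (p.1 : ι → ℝ)} := by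
    refine isClosed_le continuous_const ?_
    have h1 : Continuous fun p : Metric.sphere (0 : ι → ℝ) 1 × Matrix ι ι ℝ => (p.1 : ι → ℝ) :=
      continuous_subtype_val.comp continuous_fst
    exact h1.dotProduct (continuous_snd.matrix_mulVec h1)
  have h := (isClosedMap_snd_of_compactSpace _ hcl).isOpen_compl
  convert h using 1
  ext M
  simp only [negativeForms, mem_ofPred_eq, mem_compl_iff, mem_image, Prod.exists, exists_eq_right,
    not_exists, not_le, Subtype.forall, mem_sphere_iff_norm, sub_zero]
  refine ⟨fun h x hx => h x (by rintro rfl; simp at hx), fun h x hx => ?_⟩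
  have hx' : ‖x‖ ≠ 0 := norm_ne_zero_iff.2 hx
  have := h (‖x‖⁻¹ • x) (by rw [norm_smul, norm_inv, norm_norm, inv_mul_cancel₀ hx'])
  rw [mulVec_smul, dotProduct_smul, smul_dotProduct, smul_eq_mul, smul_eq_mul, ← mul_assoc] at this
  have h2 : 0 < ‖x‖⁻¹ * ‖x‖⁻¹ := by positivity
  exact (pos_iff_neg_of_mul_neg this).1 h2

theorem neg_one_mem_negativeForms (ι : Type*) [Fintype ι] [DecidableEq ι] :
    (-1 : Matrix ι ι ℝ) ∈ negativeForms ι := by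
  intro x hx
  rw [neg_mulVec, one_mulVec, dotProduct_neg, neg_lt_zero]
  simpa using dotProduct_star_self_pos_iff.2 hx

/-- A linear functional on symmetric matrices is given by a symmetric matrix via the trace. -/
theorem exists_trace_representation {ι : Type*} [Fintype ι] [DecidableEq ι]
    (f : Matrix ι ι ℝ →ₗ[ℝ] ℝ) :
    ∃ Z : Matrix ι ι ℝ, Zᵀ = Z ∧ ∀ M : Matrix ι ι ℝ, Mᵀ = M → f M = (Z * M).trace := by
  set Y : Matrix ι ι ℝ := Matrix.of fun i j => f (Matrix.single i j 1) with hY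
  have hf : ∀ M, f M = (Yᵀ * M).trace := by
    intro M
    conv_lhs => rw [Matrix.matrix_eq_sum_single M]
    simp only [map_sum, Matrix.trace, Matrix.diag, Matrix.mul_apply, transpose_apply, hY, of_apply]
    rw [Finset.sum_comm]
    refine Finset.sum_congr rfl fun i _ => Finset.sum_congr rfl fun j _ => ?_
    rw [← mul_one (M j i), ← smul_eq_mul, ← Matrix.smul_single, map_smul, smul_eq_mul, mul_comm]
    simp
  -- Symmetrising the representing matrix leaves the values on symmetric M unchanged.
  refine ⟨(2⁻¹ : ℝ) • (Y + Yᵀ), by simp [add_comm], fun M hM => ?_⟩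
  have h1 : (Y * M).trace = f M := by
    rw [hf, ← trace_transpose, transpose_mul, hM, trace_mul_comm]
  rw [Matrix.smul_mul, trace_smul, Matrix.add_mul, trace_add, h1, ← hf, smul_eq_mul]
  ring

/-- The strict Kalman–Yakubovich–Popov inequality for scalar transfer functions of relative
degree one; the realisation need not be minimal. -/
theorem exists_symmetric_kyp {ι : Type*} [Fintype ι] [DecidableEq ι] (A : Matrix ι ι ℝ)
    (b c : ι → ℝ) (h0 : 0 < c ⬝ᵥ b) (h1 : c ⬝ᵥ A *ᵥ b < 0)
    (hw : ∀ (ω : ℝ) (x : ι → ℂ) (u : ℂ),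
      complexMatrix A *ᵥ x + u • complexVector b = ((ω : ℂ) * Complex.I) • x → x ≠ 0 →
        0 < (star u * (complexVector c ⬝ᵥ x)).re) :
    ∃ P : Matrix ι ι ℝ, Pᵀ = P ∧ P *ᵥ b = c ∧ Aᵀ * P + P * A ∈ negativeForms ι := by
  by_contra! hcon
  set T : Set (Matrix ι ι ℝ) := {M | ∃ P : Matrix ι ι ℝ, Pᵀ = P ∧ P *ᵥ b = c ∧
    Aᵀ * P + P * A = M} with hT
  have hTc : Convex ℝ T := by
    rintro _ ⟨P, hP, hPb, rfl⟩ _ ⟨R, hR, hRb, rfl⟩ s t _ _ hst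
    refine ⟨s • P + t • R, by simp [hP, hR], ?_, ?_⟩
    · rw [add_mulVec, smul_mulVec, smul_mulVec, hPb, hRb, ← add_smul, hst, one_smul]
    · simp only [Matrix.mul_add, Matrix.add_mul, Matrix.mul_smul, Matrix.smul_mul, smul_add]
      abel
  have hdisj : Disjoint (negativeForms ι) T := by
    rw [Set.disjoint_left]
    rintro _ hM ⟨P, hP, hPb, rfl⟩
    exact hcon P hP hPb hM
  obtain ⟨f, u, hfs, hft⟩ := geometric_hahn_banach_open (convex_negativeForms ι)
    (isOpen_negativeForms ι) hTc hdisj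
  -- The negative forms are a cone, so the separating bound survives scaling; this forces f ≤ 0 on
  -- them and u ≥ 0.
  have hscale : ∀ N ∈ negativeForms ι, ∀ t : ℝ, 0 < t → t * f N < u := by
    intro N hN t ht
    have : t • N ∈ negativeForms ι := by
      intro x hx
      rw [smul_mulVec, dotProduct_smul]
      exact mul_neg_of_pos_of_neg ht (hN x hx)
    simpa using hfs _ this
  have hfneg : ∀ N ∈ negativeForms ι, f N ≤ 0 := by
    intro N hN
    by_contra! hpos
    have := hscale N hN ((|u| + 1) / f N) (by positivity)
    rw [div_mul_cancel₀ _ hpos.ne'] at this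
    linarith [le_abs_self u]
  have hu : 0 ≤ u := by
    have h := neg_one_mem_negativeForms ι
    by_contra! hneg
    have hf0 := hfneg _ h
    rcases hf0.eq_or_lt with h2 | h2
    · have := hscale _ h 1 one_pos
      rw [h2] at this
      linarith
    · have := hscale _ h (u / f (-1)) (div_pos_of_neg_of_neg hneg h2)
      rw [div_mul_cancel₀ _ h2.ne] at this
      exact lt_irrefl _ this
  obtain ⟨Z, hZs, hZ⟩ := exists_trace_representation f.toLinearMap
  have hZf : ∀ M : Matrix ι ι ℝ, Mᵀ = M → f M = (Z * M).trace := hZ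
  have hZpsd : Z.PosSemidef := by
    refine PosSemidef.of_dotProduct_mulVec_nonneg
      (by rw [IsHermitian, conjTranspose_eq_transpose_of_trivial, hZs]) fun x => ?_
    rw [star_trivial]
    have hx : x ⬝ᵥ Z *ᵥ x = f (vecMulVec x x) := by
      rw [hZf _ (transpose_vecMulVec x x), mul_vecMulVec, trace_vecMulVec, dotProduct_comm]
    -- -xxᵀ is only semidefinite; it is perturbed into the open cone, and δ → 0 afterwards.
    have hδ : ∀ δ : ℝ, 0 < δ → 0 ≤ f (vecMulVec x x) + δ * f 1 := by
      intro δ hδ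
      have hmem : -(vecMulVec x x) + δ • (-1 : Matrix ι ι ℝ) ∈ negativeForms ι := by
        intro y hy
        have hy1 := neg_one_mem_negativeForms ι y hy
        rw [add_mulVec, smul_mulVec, dotProduct_add, dotProduct_smul, neg_mulVec, dotProduct_neg,
          vecMulVec_mulVec, dotProduct_comm y]
        have h3 : (MulOpposite.op (x ⬝ᵥ y) • x) ⬝ᵥ y = (x ⬝ᵥ y) * (x ⬝ᵥ y) := by
          simp
        rw [h3, smul_eq_mul]
        nlinarith [mul_self_nonneg (x ⬝ᵥ y)]
      have := hfneg _ hmem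
      simp only [map_add, map_neg, map_smul, smul_eq_mul] at this
      linarith
    rw [hx]
    have hlim : Tendsto (fun δ : ℝ => f (vecMulVec x x) + δ * f 1) (𝓝[>] 0)
        (𝓝 (f (vecMulVec x x) + 0 * f 1)) :=
      (((continuous_id.mul continuous_const).const_add _).tendsto 0).mono_left nhdsWithin_le_nhds
    rw [zero_mul, add_zero] at hlim
    exact ge_of_tendsto hlim (eventually_mem_nhdsWithin.mono fun δ h => hδ δ h)
  obtain ⟨P₀, hP₀⟩ : ∃ P : Matrix ι ι ℝ, P = (c ⬝ᵥ b)⁻¹ • vecMulVec c c := ⟨_, rfl⟩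
  have hP₀s : P₀ᵀ = P₀ := by rw [hP₀, transpose_smul, transpose_vecMulVec]
  have hP₀b : P₀ *ᵥ b = c := by
    rw [hP₀, smul_mulVec, vecMulVec_mulVec]
    ext i
    simp [h0.ne']
  have hsym : ∀ P : Matrix ι ι ℝ, Pᵀ = P → (Aᵀ * P + P * A)ᵀ = Aᵀ * P + P * A := by
    intro P hP
    rw [transpose_add, transpose_mul, transpose_mul, transpose_transpose, hP, add_comm]
  have hval : ∀ P : Matrix ι ι ℝ, Pᵀ = P →
      f (Aᵀ * P + P * A) = ((A * Z + Z * Aᵀ) * P).trace := by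
    intro P hP
    rw [hZf _ (hsym P hP), Matrix.mul_add, Matrix.add_mul, trace_add, trace_add, add_comm,
      ← Matrix.mul_assoc, trace_mul_comm, ← Matrix.mul_assoc, ← Matrix.mul_assoc]
  have hZ0 : Z ≠ 0 := by
    rintro rfl
    have h2 := hft _ ⟨P₀, hP₀s, hP₀b, rfl⟩
    rw [hZf _ (hsym _ hP₀s), Matrix.zero_mul, trace_zero] at h2
    have h3 := hfs _ (neg_one_mem_negativeForms ι)
    rw [hZf _ (by simp), Matrix.zero_mul, trace_zero] at h3
    linarith
  set Q : Matrix ι ι ℝ := 1 - (c ⬝ᵥ b)⁻¹ • vecMulVec b c with hQ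
  have hQb : Q *ᵥ b = 0 := by
    rw [hQ, sub_mulVec, one_mulVec, smul_mulVec, vecMulVec_mulVec]
    ext i
    simp [h0.ne']
  set K : Matrix ι ι ℝ := Q * (A * Z + Z * Aᵀ) * Qᵀ with hK
  have hKs : Kᵀ = K := by
    rw [hK]
    simp only [transpose_mul, transpose_add, transpose_transpose, hZs]
    rw [add_comm, Matrix.mul_assoc]
  have hK0 : K = 0 := by
    have hRs : (Qᵀ * K * Q)ᵀ = Qᵀ * K * Q := by
      simp only [transpose_mul, transpose_transpose, hKs, Matrix.mul_assoc]
    have hRb : (Qᵀ * K * Q) *ᵥ b = 0 := by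
      rw [← mulVec_mulVec, hQb, mulVec_zero]
    -- Since Q b = 0, the line P₀ + r QᵀKQ consists of admissible points. A lower bound along it
    -- forces its slope tr(K²) to vanish.
    have hr : ∀ r : ℝ, u ≤ f (Aᵀ * P₀ + P₀ * A) + r * (K * K).trace := by
      intro r
      have h2 := hft _ ⟨P₀ + r • (Qᵀ * K * Q), by rw [transpose_add, transpose_smul, hP₀s, hRs],
        by rw [add_mulVec, smul_mulVec, hRb, hP₀b, smul_zero, add_zero], rfl⟩
      rw [hval _ (by rw [transpose_add, transpose_smul, hP₀s, hRs])] at h2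
      rw [hval _ hP₀s]
      have h3 : ((A * Z + Z * Aᵀ) * (Qᵀ * K * Q)).trace = (K * K).trace := by
        rw [← Matrix.mul_assoc, trace_mul_comm, ← Matrix.mul_assoc, ← Matrix.mul_assoc, ← hK]
      rw [Matrix.mul_add, trace_add, Matrix.mul_smul, trace_smul, h3, smul_eq_mul] at h2
      exact h2
    have hKK : (K * K).trace = 0 := by
      by_contra hne
      have := hr (-(f (Aᵀ * P₀ + P₀ * A) - u + 1) / (K * K).trace)
      rw [div_mul_cancel₀ _ hne] at this
      linarith
    rw [← trace_conjTranspose_mul_self_eq_zero_iff, conjTranspose_eq_transpose_of_trivial, hKs, hKK]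
  have hneg := dual_value_neg A Z b c h0 h1 hw hZpsd hZ0 hK0
  -- The value at P₀ is 2 (c·AZc)/(c·b), which separation makes nonnegative.
  have hge := hu.trans (hft _ ⟨P₀, hP₀s, hP₀b, rfl⟩)
  have hZA : c ⬝ᵥ (Z * Aᵀ) *ᵥ c = c ⬝ᵥ (A * Z) *ᵥ c := by
    rw [dotProduct_mulVec, ← mulVec_transpose, transpose_mul, transpose_transpose, hZs,
      dotProduct_comm]
  rw [hval _ hP₀s, hP₀, Matrix.mul_smul, trace_smul, mul_vecMulVec, trace_vecMulVec,
    dotProduct_comm _ c, add_mulVec, dotProduct_add, hZA, smul_eq_mul] at hge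
  have h4 := mul_neg_of_pos_of_neg (inv_pos.2 h0)
    (show c ⬝ᵥ (A * Z) *ᵥ c + c ⬝ᵥ (A * Z) *ᵥ c < 0 by linarith)
  linarith

end KYP

/-! ### Lyapunov's inequality -/

section Lyapunov

open Filter Topology

theorem not_mem_spectrum_iff_isUnit {ι : Type*} [Fintype ι] [DecidableEq ι] (M : Matrix ι ι ℂ)
    (z : ℂ) : z ∉ spectrum ℂ M ↔ IsUnit (z • (1 : Matrix ι ι ℂ) - M) := by
  rw [spectrum.notMem_iff, Algebra.algebraMap_eq_smul_one]

theorem mem_spectrum_iff_exists_eigenvector {ι : Type*} [Fintype ι] [DecidableEq ι]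
    (M : Matrix ι ι ℂ) (z : ℂ) : z ∈ spectrum ℂ M ↔ ∃ v ≠ 0, M *ᵥ v = z • v := by
  have h := not_mem_spectrum_iff_isUnit M z
  rw [isUnit_iff_isUnit_det, isUnit_iff_ne_zero, not_iff_not] at h
  rw [h, ← exists_mulVec_eq_zero_iff]
  simp only [sub_mulVec, smul_mulVec, one_mulVec, sub_eq_zero, eq_comm]

open scoped Matrix.Norms.Operator in
/-- The powers of a matrix whose eigenvalues lie in the open unit disc tend to zero. -/
theorem tendsto_pow_zero_of_spectrum {ι : Type*} [Fintype ι] [DecidableEq ι] (M : Matrix ι ι ℂ)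
    (h : ∀ z ∈ spectrum ℂ M, ‖z‖ < 1) : Tendsto (fun k : ℕ => M ^ k) atTop (𝓝 0) := by
  cases isEmpty_or_nonempty ι
  · have : ∀ k : ℕ, M ^ k = 0 := fun k => Subsingleton.elim _ _
    simp [this]
  have hlt : spectralRadius ℂ M < 1 := by
    have := spectrum.spectralRadius_lt_of_forall_lt M (r := 1) (fun z hz => by
      exact_mod_cast h z hz)
    exact_mod_cast this
  -- Gelfand's formula: ‖Mᵏ‖^(1/k) eventually falls below some ρ < 1.
  obtain ⟨ρ, hρ1, hρ2⟩ := ENNReal.lt_iff_exists_nnreal_btwn.1 hlt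
  have hev := (spectrum.pow_nnnorm_pow_one_div_tendsto_nhds_spectralRadius M).eventually_lt_const hρ1
  refine squeeze_zero_norm' (a := fun k => (ρ : ℝ) ^ k) ?_
    (tendsto_pow_atTop_nhds_zero_of_lt_one ρ.coe_nonneg (by exact_mod_cast hρ2))
  filter_upwards [hev, eventually_gt_atTop 0] with k hk hk0
  have h1 : ((‖M ^ k‖₊ : ENNReal) ^ (1 / k : ℝ)) ^ k ≤ (ρ : ENNReal) ^ k :=
    pow_le_pow_left' hk.le k
  rw [← ENNReal.rpow_natCast, ← ENNReal.rpow_mul, one_div,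
    inv_mul_cancel₀ (by exact_mod_cast hk0.ne'), ENNReal.rpow_one] at h1
  exact_mod_cast h1

/-- The point 1 is not an eigenvalue, so the Cayley transform (A + 1)(A - 1)⁻¹ is a genuine one. -/
theorem IsHurwitz.isUnit_sub_one {ι : Type*} [Fintype ι] [DecidableEq ι] {A : Matrix ι ι ℝ}
    (hA : IsHurwitz A) : IsUnit (A - 1) := by
  rw [isUnit_iff_isUnit_det, isUnit_iff_ne_zero]
  intro h
  obtain ⟨v, hv, hAv⟩ := exists_mulVec_eq_zero_iff.2 h
  rw [sub_mulVec, one_mulVec, sub_eq_zero] at hAv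
  have := hA 1 ((mem_spectrum_iff_exists_eigenvector _ _).2 ⟨complexVector v, ?_, ?_⟩)
  · norm_num at this
  · intro h0
    apply hv
    ext i
    simpa using congrFun h0 i
  · rw [complexMatrix_mulVec, hAv, one_smul]

/-- The Cayley transform of a Hurwitz matrix has its eigenvalues in the open unit disc. -/
theorem IsHurwitz.norm_lt_one_of_mem_spectrum_cayley {ι : Type*} [Fintype ι] [DecidableEq ι]
    {A : Matrix ι ι ℝ} (hA : IsHurwitz A) :
    ∀ z ∈ spectrum ℂ (complexMatrix ((A + 1) * (A - 1)⁻¹)), ‖z‖ < 1 := by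
  intro z hz
  obtain ⟨v, hv, hTv⟩ := (mem_spectrum_iff_exists_eigenvector _ _).1 hz
  have hone : complexMatrix (1 : Matrix ι ι ℝ) = 1 := by simp
  have hinv : complexMatrix (A - 1) * complexMatrix (A - 1)⁻¹ = 1 := by
    rw [← complexMatrix_mul, mul_nonsing_inv _ ((isUnit_iff_isUnit_det _).1 hA.isUnit_sub_one),
      hone]
  set y := complexMatrix (A - 1)⁻¹ *ᵥ v with hy
  have hvy : v = complexMatrix A *ᵥ y - y := by
    have h : complexMatrix (A - 1) *ᵥ y = v := by rw [hy, mulVec_mulVec, hinv, one_mulVec]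
    rw [← h, complexMatrix, Matrix.map_sub _ (map_sub _), sub_mulVec]
    change _ - complexMatrix 1 *ᵥ y = _
    rw [hone, one_mulVec]
  have hy0 : y ≠ 0 := by
    intro h0
    rw [h0] at hvy
    simp at hvy
    exact hv hvy
  rw [complexMatrix_mul, ← mulVec_mulVec, ← hy, complexMatrix, Matrix.map_add _ (map_add _),
    add_mulVec] at hTv
  change _ + complexMatrix 1 *ᵥ y = _ at hTv
  rw [hone, one_mulVec, hvy] at hTv
  -- An eigenvalue z of the Cayley transform gives the eigenvalue (z + 1)/(z - 1) of A, whose real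
  -- part has the sign of |z|² - 1.
  have hkey : (z - 1) • complexMatrix A *ᵥ y = (z + 1) • y := by
    rw [smul_sub] at hTv
    have h1 := sub_eq_iff_eq_add.1 hTv.symm
    rw [sub_smul, add_smul, one_smul, one_smul, h1]
    abel
  have hz1 : z - 1 ≠ 0 := by
    intro h1
    rw [h1, zero_smul, sub_eq_zero.1 h1] at hkey
    norm_num at hkey
    exact hy0 (by simpa using hkey.symm)
  have hre := hA ((z + 1) / (z - 1)) ((mem_spectrum_iff_exists_eigenvector _ _).2 ⟨y, hy0, by
    rw [div_eq_inv_mul, mul_smul, ← hkey, smul_smul, inv_mul_cancel₀ hz1, one_smul]⟩)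
  rw [Complex.div_re, ← add_div, div_neg_iff] at hre
  have hpos := Complex.normSq_pos.2 hz1
  have hsq : z.re * z.re + z.im * z.im < 1 := by
    rcases hre with h | h
    · linarith [h.2]
    · have := h.1
      simp at this
      nlinarith
  rw [← Complex.normSq_apply, Complex.normSq_eq_norm_sq] at hsq
  nlinarith [norm_nonneg z]

/-- Lyapunov: a symmetric solution of the strict Lyapunov inequality of a Hurwitz matrix is
positive definite. -/
theorem IsHurwitz.pos_of_lyapunov {ι : Type*} [Fintype ι] [DecidableEq ι] {A P : Matrix ι ι ℝ}
    (hA : IsHurwitz A) (hP : Pᵀ = P) (h : Aᵀ * P + P * A ∈ negativeForms ι) {x : ι → ℝ}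
    (hx : x ≠ 0) : 0 < x ⬝ᵥ P *ᵥ x := by
  set T : Matrix ι ι ℝ := (A + 1) * (A - 1)⁻¹ with hT
  have hinv : (A - 1) * (A - 1)⁻¹ = 1 :=
    mul_nonsing_inv _ ((isUnit_iff_isUnit_det _).1 hA.isUnit_sub_one)
  -- With v = (A - 1)y and Tv = (A + 1)y the form changes by 2 yᵀ(AᵀP + PA)y, so the continuous-time
  -- inequality becomes a discrete one.
  have hstep : ∀ v : ι → ℝ, v ≠ 0 → (T *ᵥ v) ⬝ᵥ P *ᵥ (T *ᵥ v) < v ⬝ᵥ P *ᵥ v := by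
    intro v hv
    set y := (A - 1)⁻¹ *ᵥ v with hy
    have hvy : v = A *ᵥ y - y := by
      have h1 : (A - 1) *ᵥ y = v := by rw [hy, mulVec_mulVec, hinv, one_mulVec]
      rw [← h1, sub_mulVec, one_mulVec]
    have hTv : T *ᵥ v = A *ᵥ y + y := by
      rw [hT, ← mulVec_mulVec, ← hy, add_mulVec, one_mulVec]
    have hy0 : y ≠ 0 := by
      intro h0
      rw [h0, mulVec_zero, sub_zero] at hvy
      exact hv hvy
    have hneg := h y hy0
    have hs : ∀ p q : ι → ℝ, p ⬝ᵥ P *ᵥ q = q ⬝ᵥ P *ᵥ p := by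
      intro p q
      rw [dotProduct_mulVec, ← mulVec_transpose, hP, dotProduct_comm]
    rw [add_mulVec, dotProduct_add, ← mulVec_mulVec, ← mulVec_mulVec, dotProduct_mulVec y Aᵀ,
      vecMul_transpose, hs y] at hneg
    rw [hTv, hvy]
    simp only [mulVec_add, mulVec_sub, dotProduct_add, dotProduct_sub, add_dotProduct,
      sub_dotProduct]
    rw [hs y (A *ᵥ y)]
    linarith
  -- Comparison with T x instead of x saves the strict first step for the limit.
  have hmono : ∀ k : ℕ, (T ^ (k + 1) *ᵥ x) ⬝ᵥ P *ᵥ (T ^ (k + 1) *ᵥ x) ≤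
      (T *ᵥ x) ⬝ᵥ P *ᵥ (T *ᵥ x) := by
    intro k
    induction k with
    | zero => simp
    | succ k ih =>
      refine le_trans ?_ ih
      rw [pow_succ' T (k + 1), ← mulVec_mulVec]
      by_cases h0 : T ^ (k + 1) *ᵥ x = 0
      · simp [h0]
      · exact (hstep _ h0).le
  have hlim : Tendsto (fun k : ℕ => T ^ k *ᵥ x) atTop (𝓝 0) := by
    have h1 := tendsto_pow_zero_of_spectrum _ hA.norm_lt_one_of_mem_spectrum_cayley
    have h2 : Tendsto (fun k : ℕ => T ^ k) atTop (𝓝 0) := by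
      refine tendsto_pi_nhds.2 fun i => tendsto_pi_nhds.2 fun j => ?_
      have h3 := (tendsto_pi_nhds.1 ((tendsto_pi_nhds.1 h1) i)) j
      have h4 : ∀ k : ℕ, complexMatrix T ^ k = complexMatrix (T ^ k) := fun k =>
        (map_pow (algebraMap ℝ ℂ).mapMatrix T k).symm
      simp only [← hT, h4] at h3
      have := (Complex.continuous_re.tendsto _).comp h3
      simpa [Function.comp_def] using this
    have h3 := ((continuous_id.matrix_mulVec (continuous_const (y := x))).tendsto
      (0 : Matrix ι ι ℝ)).comp h2
    simpa [Function.comp_def] using h3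
  have hc : Continuous fun v : ι → ℝ => v ⬝ᵥ P *ᵥ v :=
    continuous_id.dotProduct (continuous_const.matrix_mulVec continuous_id)
  have h0 : Tendsto (fun k : ℕ => (T ^ (k + 1) *ᵥ x) ⬝ᵥ P *ᵥ (T ^ (k + 1) *ᵥ x)) atTop (𝓝 0) := by
    have := (hc.tendsto 0).comp ((tendsto_add_atTop_iff_nat 1).2 hlim)
    simpa [Function.comp_def] using this
  exact (le_of_tendsto h0 (Eventually.of_forall hmono)).trans_lt (hstep x hx)

end Lyapunov

/-! ### The matrix resolvent -/

section Resolvent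

open Filter Topology Bornology

variable {ι : Type*} [Fintype ι] [DecidableEq ι]

theorem inv_eq_resolvent (M : Matrix ι ι ℂ) (s : ℂ) :
    (s • (1 : Matrix ι ι ℂ) - M)⁻¹ = resolvent M s := by
  rw [nonsing_inv_eq_ringInverse, resolvent, Algebra.algebraMap_eq_smul_one]

theorem sub_mul_resolvent {M : Matrix ι ι ℂ} {s : ℂ} (hs : s ∉ spectrum ℂ M) :
    (s • (1 : Matrix ι ι ℂ) - M) * resolvent M s = 1 := by
  rw [← inv_eq_resolvent]
  exact mul_nonsing_inv _ ((isUnit_iff_isUnit_det _).1 ((not_mem_spectrum_iff_isUnit M s).1 hs))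

theorem resolvent_mul_sub {M : Matrix ι ι ℂ} {s : ℂ} (hs : s ∉ spectrum ℂ M) :
    resolvent M s * (s • (1 : Matrix ι ι ℂ) - M) = 1 := by
  rw [← inv_eq_resolvent]
  exact nonsing_inv_mul _ ((isUnit_iff_isUnit_det _).1 ((not_mem_spectrum_iff_isUnit M s).1 hs))

open scoped Matrix.Norms.Operator in
theorem continuousAt_resolvent {M : Matrix ι ι ℂ} {s : ℂ} (hs : s ∉ spectrum ℂ M) :
    ContinuousAt (resolvent M) s :=
  (spectrum.hasDerivAt_resolvent_const_left (spectrum.notMem_iff.1 hs)).continuousAt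

open scoped Matrix.Norms.Operator in
theorem differentiableAt_linear_resolvent {M : Matrix ι ι ℂ} (g : Matrix ι ι ℂ →ₗ[ℂ] ℂ) {s : ℂ}
    (hs : s ∉ spectrum ℂ M) : DifferentiableAt ℂ (fun s => g (resolvent M s)) s :=
  (LinearMap.toContinuousLinearMap g).differentiableAt.comp s
    (spectrum.hasDerivAt_resolvent_const_left (spectrum.notMem_iff.1 hs)).differentiableAt

open scoped Matrix.Norms.Operator in
theorem tendsto_linear_resolvent (M : Matrix ι ι ℂ) (g : Matrix ι ι ℂ →ₗ[ℂ] ℂ) :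
    Tendsto (fun s => g (resolvent M s)) (cobounded ℂ) (𝓝 0) := by
  have h1 := (LinearMap.toContinuousLinearMap g).continuous.tendsto 0
  rw [map_zero] at h1
  exact h1.comp (spectrum.resolvent_tendsto_cobounded M)

open scoped Matrix.Norms.Operator in
theorem eventually_not_mem_spectrum (M : Matrix ι ι ℂ) :
    ∀ᶠ s in cobounded ℂ, s ∉ spectrum ℂ M := by
  filter_upwards [spectrum.eventually_isUnit_resolvent M] with s hs
  exact spectrum.notMem_iff.2 (spectrum.isUnit_resolvent.2 hs)

theorem finite_spectrum_matrix (M : Matrix ι ι ℂ) : (spectrum ℂ M).Finite :=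
  Matrix.finite_spectrum M

end Resolvent

/-! ### A stabilizable and detectable realisation of a stable transfer function is Hurwitz -/

section Hurwitz

open Filter Topology

/-- Two resolvent identities, one for output injection and one for state feedback. On the left, the
resolvent of M enters only through the transfer function, so where the other two resolvents are
regular it can be singular only if the transfer function is. -/
theorem resolvent_eq_of_feedback {ι κ : Type*} [Fintype ι] [DecidableEq ι] [Fintype κ]
    {M : Matrix ι ι ℂ} {B : Matrix ι κ ℂ} {C : Matrix κ ι ℂ}
    {K : Matrix κ ι ℂ} {L : Matrix ι κ ℂ} {s : ℂ} (hM : s ∉ spectrum ℂ M)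
    (hK : s ∉ spectrum ℂ (M + B * K)) (hL : s ∉ spectrum ℂ (M + L * C)) :
    resolvent (M + B * K) s - (resolvent (M + L * C) s * B -
      resolvent (M + L * C) s * L * (C * resolvent M s * B)) * K * resolvent (M + B * K) s =
        resolvent M s := by
  have h1 : resolvent M s = resolvent (M + L * C) s -
      resolvent (M + L * C) s * (L * C) * resolvent M s := by
    calc resolvent M s = resolvent (M + L * C) s * (s • (1 : Matrix ι ι ℂ) - (M + L * C)) *
          resolvent M s := by rw [resolvent_mul_sub hL, Matrix.one_mul]
      _ = resolvent (M + L * C) s * ((s • (1 : Matrix ι ι ℂ) - M) * resolvent M s) -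
          resolvent (M + L * C) s * (L * C) * resolvent M s := by noncomm_ring
      _ = _ := by rw [sub_mul_resolvent hM, Matrix.mul_one]
  have h2 : resolvent M s = resolvent (M + B * K) s -
      resolvent M s * (B * K) * resolvent (M + B * K) s := by
    calc resolvent M s = resolvent M s * ((s • (1 : Matrix ι ι ℂ) - (M + B * K)) *
          resolvent (M + B * K) s) := by rw [sub_mul_resolvent hK, Matrix.mul_one]
      _ = (resolvent M s * (s • (1 : Matrix ι ι ℂ) - M)) * resolvent (M + B * K) s -
          resolvent M s * (B * K) * resolvent (M + B * K) s := by noncomm_ring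
      _ = _ := by rw [resolvent_mul_sub hM, Matrix.one_mul]
  have h3 : resolvent (M + L * C) s * B -
      resolvent (M + L * C) s * L * (C * resolvent M s * B) = resolvent M s * B := by
    conv_rhs => rw [h1]
    simp only [Matrix.sub_mul, Matrix.mul_assoc]
  rw [h3]
  conv_rhs => rw [h2]
  simp only [Matrix.mul_assoc]

/-- A stabilizable and detectable realisation of a strictly positive real transfer function is
Hurwitz. -/
theorem isHurwitz_of_isStrictlyPositiveReal {ι κ : Type*} [Fintype ι] [DecidableEq ι]
    [Fintype κ] [DecidableEq κ] {A : Matrix ι ι ℝ} {B : Matrix ι κ ℝ}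
    {C : Matrix κ ι ℝ} (hstab : IsStabilizable A B) (hdet : IsDetectable A C)
    (hspr : IsStrictlyPositiveReal (transferFunction A B C)) : IsHurwitz A := by
  obtain ⟨K, hK⟩ := hstab
  obtain ⟨L, hL⟩ := hdet
  obtain ⟨ε, hε, G, ⟨S, hS, hGW⟩, hG, -, -⟩ := hspr
  intro z hz
  by_contra! hre
  have hK' : complexMatrix (A + B * K) = complexMatrix A + complexMatrix B * complexMatrix K := by
    rw [← complexMatrix_mul]; exact Matrix.map_add _ (map_add _) _ _
  have hL' : complexMatrix (A + L * C) = complexMatrix A + complexMatrix L * complexMatrix C := by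
    rw [← complexMatrix_mul]; exact Matrix.map_add _ (map_add _) _ _
  have hzK : z ∉ spectrum ℂ (complexMatrix A + complexMatrix B * complexMatrix K) := fun h =>
    (hK z (by change z ∈ spectrum ℂ (complexMatrix (A + B * K)); rwa [hK'])).not_ge hre
  have hzL : z ∉ spectrum ℂ (complexMatrix A + complexMatrix L * complexMatrix C) := fun h =>
    (hL z (by change z ∈ spectrum ℂ (complexMatrix (A + L * C)); rwa [hL'])).not_ge hre
  have hev : ∀ (T : Set ℂ), T.Finite → ∀ᶠ s in 𝓝[≠] z, s ∉ T := by
    intro T hT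
    have h1 : (T \ {z})ᶜ ∈ 𝓝 z := (hT.subset sdiff_subset).isClosed.isOpen_compl.mem_nhds (by simp)
    filter_upwards [mem_nhdsWithin_of_mem_nhds h1, self_mem_nhdsWithin] with s hs hsz hsT
    exact hs ⟨hsT, hsz⟩
  have hGc : ContinuousAt (fun s : ℂ => G (s + ε)) z := by
    have hmem : z + ε ∈ {s : ℂ | 0 < s.re} := by
      simp only [mem_ofPred_eq, Complex.add_re, Complex.ofReal_re]
      linarith
    have hopen : IsOpen {s : ℂ | 0 < s.re} := isOpen_lt continuous_const Complex.continuous_re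
    have h1 : ContinuousAt G (z + ε) := continuousAt_pi.2 fun i => continuousAt_pi.2 fun j =>
      ((hG i j).differentiableAt (hopen.mem_nhds hmem)).continuousAt
    exact ContinuousAt.comp (f := fun s : ℂ => s + (ε : ℂ)) h1 (by fun_prop)
  -- The feedback formula for the resolvent of A, with the analytic G in place of the transfer
  -- function; it is continuous at z.
  set F : ℂ → Matrix ι ι ℂ := fun s =>
    resolvent (complexMatrix A + complexMatrix B * complexMatrix K) s -
      (resolvent (complexMatrix A + complexMatrix L * complexMatrix C) s * complexMatrix B -
      resolvent (complexMatrix A + complexMatrix L * complexMatrix C) s * complexMatrix L *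
        G (s + ε)) * complexMatrix K *
      resolvent (complexMatrix A + complexMatrix B * complexMatrix K) s with hF
  have hFc : ContinuousAt F z := by
    have h1 : Continuous fun p : Matrix ι ι ℂ × Matrix ι ι ℂ × Matrix κ κ ℂ =>
        p.1 - (p.2.1 * complexMatrix B - p.2.1 * complexMatrix L * p.2.2) * complexMatrix K *
          p.1 := by
      fun_prop
    exact ContinuousAt.comp (f := fun s =>
      (resolvent (complexMatrix A + complexMatrix B * complexMatrix K) s,
      resolvent (complexMatrix A + complexMatrix L * complexMatrix C) s, G (s + ε)))
      h1.continuousAt ((continuousAt_resolvent hzK).prodMk ((continuousAt_resolvent hzL).prodMk hGc))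
  have hcont : Tendsto (fun s : ℂ => F s * (s • (1 : Matrix ι ι ℂ) - complexMatrix A)) (𝓝[≠] z)
      (𝓝 (F z * (z • (1 : Matrix ι ι ℂ) - complexMatrix A))) := by
    refine (ContinuousAt.mul hFc ?_).tendsto.mono_left nhdsWithin_le_nhds
    exact Continuous.continuousAt (by fun_prop)
  -- Near z, F is the resolvent of A; in the limit F z is a left inverse of z - A.
  have hone : ∀ᶠ s in 𝓝[≠] z, F s * (s • (1 : Matrix ι ι ℂ) - complexMatrix A) = 1 := by
    have hSfin : ((fun s : ℂ => s + (ε : ℂ)) ⁻¹' S).Finite :=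
      hS.preimage (add_left_injective _).injOn
    have hpos : ∀ᶠ s : ℂ in 𝓝[≠] z, 0 < (s + ε).re := by
      refine eventually_nhdsWithin_of_eventually_nhds ?_
      refine (Continuous.tendsto (f := fun s : ℂ => (s + ε).re) (by fun_prop) z).eventually_const_lt ?_
      simp only [Complex.add_re, Complex.ofReal_re]
      linarith
    filter_upwards [hev _ (finite_spectrum_matrix (complexMatrix A)), hev _ (finite_spectrum_matrix
      (complexMatrix A + complexMatrix B * complexMatrix K)), hev _ (finite_spectrum_matrix
      (complexMatrix A + complexMatrix L * complexMatrix C)), hev _ hSfin, hpos] with s h1 h2 h3 h4 h5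
    have hW : G (s + ε) = complexMatrix C * resolvent (complexMatrix A) s * complexMatrix B := by
      have h := hGW _ h5 h4
      simpa only [add_sub_cancel_right, transferFunction, inv_eq_resolvent] using h
    rw [hF]
    simp only [hW]
    rw [resolvent_eq_of_feedback h1 h2 h3, resolvent_mul_sub h1]
  have heq := tendsto_nhds_unique hcont ((tendsto_congr' hone).2 tendsto_const_nhds)
  refine (not_mem_spectrum_iff_isUnit (complexMatrix A) z).2 ?_ hz
  exact (isUnit_iff_isUnit_det _).2 (isUnit_det_of_left_inverse heq)

end Hurwitz

/-! ### Scalar transfer functions with nonnegative real part -/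

section Scalar

open Filter Topology Bornology

/-- The linear functional `R ↦ c N R b`. -/
def sandwich {ι : Type*} [Fintype ι] (c b : ι → ℂ) (N : Matrix ι ι ℂ) : Matrix ι ι ℂ →ₗ[ℂ] ℂ where
  toFun R := c ⬝ᵥ (N * R) *ᵥ b
  map_add' R S := by rw [Matrix.mul_add, add_mulVec, dotProduct_add]
  map_smul' r R := by rw [Matrix.mul_smul, smul_mulVec, dotProduct_smul]; rfl

theorem sandwich_apply {ι : Type*} [Fintype ι] (c b : ι → ℂ) (N R : Matrix ι ι ℂ) :
    sandwich c b N R = c ⬝ᵥ (N * R) *ᵥ b := rfl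

variable {ι : Type*} [Fintype ι] [DecidableEq ι]

/-- This is s R(s) = 1 + M R(s) between c Mᵏ and b; iterated, it yields the expansion at infinity in
the Markov parameters. -/
theorem mul_sandwich_resolvent (c b : ι → ℂ) {M : Matrix ι ι ℂ} {s : ℂ} (hs : s ∉ spectrum ℂ M)
    (k : ℕ) : s * sandwich c b (M ^ k) (resolvent M s) =
      c ⬝ᵥ (M ^ k) *ᵥ b + sandwich c b (M ^ (k + 1)) (resolvent M s) := by
  have h : s • resolvent M s = 1 + M * resolvent M s := by
    have := sub_mul_resolvent hs
    rw [Matrix.sub_mul, Matrix.smul_mul, Matrix.one_mul, sub_eq_iff_eq_add] at this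
    exact this
  rw [← smul_eq_mul, ← map_smul, h, map_add, sandwich_apply, Matrix.mul_one, sandwich_apply,
    sandwich_apply, ← Matrix.mul_assoc, ← pow_succ]

theorem pow_mul_sandwich_resolvent (c b : ι → ℂ) {M : Matrix ι ι ℂ} {s : ℂ}
    (hs : s ∉ spectrum ℂ M) (r : ℕ) (h : ∀ k < r, c ⬝ᵥ (M ^ k) *ᵥ b = 0) :
    s ^ r * sandwich c b 1 (resolvent M s) = sandwich c b (M ^ r) (resolvent M s) := by
  induction r with
  | zero => simp
  | succ r ih =>
    rw [pow_succ', mul_assoc, ih fun k hk => h k (hk.trans r.lt_succ_self),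
      mul_sandwich_resolvent c b hs, h r r.lt_succ_self, zero_add]

/-- The leading term at infinity: if c·Mʳb ≠ 0, the relative degree is r + 1. -/
theorem tendsto_pow_mul_sandwich_resolvent (c b : ι → ℂ) (M : Matrix ι ι ℂ) (r : ℕ)
    (h : ∀ k < r, c ⬝ᵥ (M ^ k) *ᵥ b = 0) :
    Tendsto (fun s => s ^ (r + 1) * sandwich c b 1 (resolvent M s)) (cobounded ℂ)
      (𝓝 (c ⬝ᵥ (M ^ r) *ᵥ b)) := by
  have h1 := (tendsto_linear_resolvent M (sandwich c b (M ^ (r + 1)))).const_add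
    (c ⬝ᵥ (M ^ r) *ᵥ b)
  rw [add_zero] at h1
  refine h1.congr' ?_
  filter_upwards [eventually_not_mem_spectrum M] with s hs
  rw [pow_succ' s, mul_assoc, pow_mul_sandwich_resolvent c b hs r h, mul_sandwich_resolvent c b hs]

/-- If all Markov parameters vanish, then so does the transfer function. -/
theorem sandwich_resolvent_eq_zero (c b : ι → ℂ) {M : Matrix ι ι ℂ}
    (h : ∀ k, c ⬝ᵥ (M ^ k) *ᵥ b = 0) {s : ℂ} (hs : s ∉ spectrum ℂ M) :
    sandwich c b 1 (resolvent M s) = 0 := by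
  -- The Krylov space of b is invariant under s - M, which is injective and so surjective on it.
  -- Thus R(s) b stays in a space annihilated by c.
  set V : Submodule ℂ (ι → ℂ) := Submodule.span ℂ (range fun k : ℕ => (M ^ k) *ᵥ b) with hV
  set T : (ι → ℂ) →ₗ[ℂ] (ι → ℂ) := (s • (1 : Matrix ι ι ℂ) - M).mulVecLin with hT
  have hTV : ∀ v ∈ V, T v ∈ V := by
    intro v hv
    have hM : M *ᵥ v ∈ V := by
      have : V ≤ V.comap M.mulVecLin := by
        rw [hV, Submodule.span_le]
        rintro _ ⟨k, rfl⟩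
        refine Submodule.subset_span ⟨k + 1, ?_⟩
        simp only [mulVecLin_apply, mulVec_mulVec, pow_succ']
      exact this hv
    rw [hT, mulVecLin_apply, sub_mulVec, smul_mulVec, one_mulVec]
    exact V.sub_mem (V.smul_mem s hv) hM
  have hinj : Function.Injective (T.restrict hTV) := by
    intro v w hvw
    have h1 : T v = T w := congrArg Subtype.val hvw
    have h2 := congrArg (resolvent M s *ᵥ ·) h1
    simp only [hT, mulVecLin_apply, mulVec_mulVec, resolvent_mul_sub hs, one_mulVec] at h2
    exact Subtype.ext h2
  have hb : b ∈ V := Submodule.subset_span ⟨0, by simp⟩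
  obtain ⟨⟨x, hx⟩, hxb⟩ := LinearMap.injective_iff_surjective.1 hinj ⟨b, hb⟩
  have hxb' : T x = b := congrArg Subtype.val hxb
  have hcV : ∀ v ∈ V, c ⬝ᵥ v = 0 := by
    intro v hv
    induction hv using Submodule.span_induction with
    | mem v hv => obtain ⟨k, rfl⟩ := hv; exact h k
    | zero => simp
    | add v w _ _ h1 h2 => rw [dotProduct_add, h1, h2, add_zero]
    | smul r v _ h1 => rw [dotProduct_smul, h1, smul_zero]
  rw [sandwich_apply, Matrix.one_mul, ← hxb', hT, mulVecLin_apply, mulVec_mulVec,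
    resolvent_mul_sub hs, one_mulVec, hcV x hx]

theorem tendsto_ray_cobounded {e : ℂ} (he : e ≠ 0) :
    Tendsto (fun t : ℝ => (t : ℂ) * e) atTop (cobounded ℂ) := by
  rw [← tendsto_norm_atTop_iff_cobounded]
  have h1 : Tendsto (fun t : ℝ => |t| * ‖e‖) atTop atTop :=
    tendsto_abs_atTop_atTop.atTop_mul_const (norm_pos_iff.2 he)
  simpa using h1

/-- A strictly proper transfer function that has nonnegative real part on the closed right half
plane and is not identically zero has relative degree one and positive high-frequency gain. -/
theorem highFrequencyGain_pos (A : Matrix ι ι ℝ) (b c : ι → ℝ)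
    (hre : ∀ s : ℂ, 0 ≤ s.re → s ∉ spectrum ℂ (complexMatrix A) →
      0 ≤ (sandwich (complexVector c) (complexVector b) 1 (resolvent (complexMatrix A) s)).re)
    (hne : ∃ s ∉ spectrum ℂ (complexMatrix A),
      sandwich (complexVector c) (complexVector b) 1 (resolvent (complexMatrix A) s) ≠ 0) :
    0 < c ⬝ᵥ b := by
  set f : ℂ → ℂ := fun s =>
    sandwich (complexVector c) (complexVector b) 1 (resolvent (complexMatrix A) s)
  have hmarkov : ∀ k : ℕ, complexVector c ⬝ᵥ (complexMatrix A ^ k) *ᵥ complexVector b =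
      ((c ⬝ᵥ (A ^ k) *ᵥ b : ℝ) : ℂ) := by
    intro k
    rw [← complexVector_dotProduct, ← complexMatrix_mulVec]
    congr 2
    exact (map_pow (algebraMap ℝ ℂ).mapMatrix A k).symm
  -- along the ray through `e` with `e ^ (r + 1)` real
  have hray : ∀ (r : ℕ) (e : ℂ) (σ : ℝ), e ≠ 0 → 0 ≤ e.re → e ^ (r + 1) = σ →
      (∀ k < r, c ⬝ᵥ (A ^ k) *ᵥ b = 0) → 0 ≤ σ * (c ⬝ᵥ (A ^ r) *ᵥ b) := by
    intro r e σ he her heσ hz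
    have h1 := (tendsto_pow_mul_sandwich_resolvent (complexVector c) (complexVector b)
      (complexMatrix A) r (fun k hk => by rw [hmarkov, hz k hk, Complex.ofReal_zero])).comp
      (tendsto_ray_cobounded he)
    rw [hmarkov] at h1
    have h2 := (Complex.continuous_re.tendsto _).comp (h1.const_mul (σ : ℂ))
    rw [← Complex.ofReal_mul, Complex.ofReal_re] at h2
    refine ge_of_tendsto h2 ?_
    filter_upwards [(tendsto_ray_cobounded he).eventually
      (eventually_not_mem_spectrum (complexMatrix A)), eventually_ge_atTop 0] with t ht ht0
    have h3 := hre ((t : ℂ) * e) (by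
      rw [Complex.re_ofReal_mul]
      exact mul_nonneg ht0 her) ht
    simp only [Function.comp_apply]
    have h4 : (σ : ℂ) * (((t : ℂ) * e) ^ (r + 1) * f ((t : ℂ) * e)) =
        ((σ * σ * t ^ (r + 1) : ℝ) : ℂ) * f ((t : ℂ) * e) := by
      rw [mul_pow, heσ]
      push_cast
      ring
    change 0 ≤ ((σ : ℂ) * (((t : ℂ) * e) ^ (r + 1) * f ((t : ℂ) * e))).re
    rw [h4, Complex.re_ofReal_mul]
    exact mul_nonneg (mul_nonneg (mul_self_nonneg σ) (pow_nonneg ht0 _)) h3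
  have h0 : 0 ≤ c ⬝ᵥ b := by
    have := hray 0 1 1 one_ne_zero (by simp) (by simp) (by simp)
    simpa using this
  refine h0.lt_of_ne fun hzero => ?_
  have hall : ∀ r : ℕ, c ⬝ᵥ (A ^ r) *ᵥ b = 0 := by
    intro r
    induction r using Nat.strong_induction_on with
    | _ r ih =>
      rcases Nat.eq_zero_or_pos r with rfl | hr
      · simpa using hzero.symm
      -- The directions 1 and exp(iπ/(r+1)) have (r+1)-th powers 1 and -1, which give opposite
      -- inequalities; r ≥ 1 keeps the second in the closed right half-plane.
      have hpos : 0 ≤ c ⬝ᵥ (A ^ r) *ᵥ b := by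
        simpa using hray r 1 1 one_ne_zero (by simp) (by simp) ih
      have hr1 : (1 : ℝ) ≤ r := by exact_mod_cast hr
      have hneg : 0 ≤ (-1 : ℝ) * (c ⬝ᵥ (A ^ r) *ᵥ b) := by
        refine hray r (Complex.exp ((Real.pi / (r + 1) : ℝ) * Complex.I)) (-1)
          (Complex.exp_ne_zero _) ?_ ?_ ih
        · rw [Complex.exp_ofReal_mul_I_re]
          refine Real.cos_nonneg_of_neg_pi_div_two_le_of_le ?_ ?_
          · have : 0 ≤ Real.pi / (r + 1) := by positivity
            linarith [Real.pi_pos]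
          · exact div_le_div_of_nonneg_left Real.pi_pos.le two_pos (by linarith)
        · rw [← Complex.exp_nat_mul]
          have : ((r + 1 : ℕ) : ℂ) * (((Real.pi / (r + 1) : ℝ) : ℂ) * Complex.I) =
              Real.pi * Complex.I := by
            have : (r : ℂ) + 1 ≠ 0 := by exact_mod_cast r.succ_ne_zero
            push_cast
            field_simp
          rw [this, Complex.exp_pi_mul_I]
          simp
      linarith
  obtain ⟨s, hs, hfs⟩ := hne
  exact hfs (sandwich_resolvent_eq_zero _ _ (fun k => by rw [hmarkov, hall, Complex.ofReal_zero]) hs)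

/-- If the real part of the transfer function is nonnegative on a vertical line to the left of
the imaginary axis, then the second Markov parameter is negative. -/
theorem second_markov_neg (A : Matrix ι ι ℝ) (b c : ι → ℝ) (h0 : 0 < c ⬝ᵥ b) {σ : ℝ} (hσ : 0 < σ)
    (hre : ∀ s : ℂ, s.re = -σ → s ∉ spectrum ℂ (complexMatrix A) →
      0 ≤ (sandwich (complexVector c) (complexVector b) 1 (resolvent (complexMatrix A) s)).re) :
    c ⬝ᵥ A *ᵥ b < 0 := by
  set f : ℂ → ℂ := fun s =>
    sandwich (complexVector c) (complexVector b) 1 (resolvent (complexMatrix A) s)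
  set g : ℂ → ℂ := fun s =>
    sandwich (complexVector c) (complexVector b) (complexMatrix A ^ 2) (resolvent (complexMatrix A) s)
  let l : ℝ → ℂ := fun ω => (-σ : ℝ) + (ω : ℂ) * Complex.I
  have hl : Tendsto l atTop (cobounded ℂ) := by
    rw [← tendsto_norm_atTop_iff_cobounded]
    refine tendsto_atTop_mono (fun ω => ?_) tendsto_id
    refine le_trans (le_abs_self _) ?_
    simpa [l] using Complex.abs_im_le_norm (l ω)
  -- As |s|² f = s̄ (c·b) + (s̄/s)(c·Ab + g) has nonnegative real part on re s = -σ, the last term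
  -- has real part at least σ (c·b). Since s̄/s → -1 and g → 0, it tends to -c·Ab.
  have hf : ∀ s ∉ spectrum ℂ (complexMatrix A), s * (s * f s) =
      s * ((c ⬝ᵥ b : ℝ) : ℂ) + ((c ⬝ᵥ A *ᵥ b : ℝ) : ℂ) + g s := by
    intro s hs
    have h1 := mul_sandwich_resolvent (complexVector c) (complexVector b) hs 0
    have h2 := mul_sandwich_resolvent (complexVector c) (complexVector b) hs 1
    rw [pow_zero, one_mulVec, complexVector_dotProduct, zero_add] at h1
    rw [pow_one, complexMatrix_mulVec, complexVector_dotProduct, one_add_one_eq_two] at h2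
    rw [pow_one] at h1
    change s * f s = _ at h1
    rw [h1, mul_add, h2, add_assoc]
  have hquot : Tendsto (fun ω => (starRingEnd ℂ (l ω)) / l ω) atTop (𝓝 (-1)) := by
    have h1 : Tendsto (fun ω => -1 - (2 * σ : ℂ) * (l ω)⁻¹) atTop (𝓝 (-1 - (2 * σ : ℂ) * 0)) :=
      ((tendsto_inv₀_cobounded.comp hl).const_mul _).const_sub _
    rw [mul_zero, sub_zero] at h1
    refine h1.congr fun ω => ?_
    have hne : l ω ≠ 0 := by
      intro h
      have := congrArg Complex.re h
      simp [l] at this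
      exact hσ.ne' this
    have hc : starRingEnd ℂ (l ω) = -l ω - 2 * σ := by
      apply Complex.ext <;> simp [l]
      ring
    rw [hc]
    field_simp
  have hlim : Tendsto (fun ω => ((starRingEnd ℂ (l ω)) / l ω *
      (((c ⬝ᵥ A *ᵥ b : ℝ) : ℂ) + g (l ω))).re) atTop (𝓝 (-(c ⬝ᵥ A *ᵥ b))) := by
    have h1 := ((tendsto_linear_resolvent (complexMatrix A) (sandwich (complexVector c)
      (complexVector b) (complexMatrix A ^ 2))).comp hl).const_add ((c ⬝ᵥ A *ᵥ b : ℝ) : ℂ)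
    have h2 := (Complex.continuous_re.tendsto _).comp (hquot.mul h1)
    rw [add_zero, neg_one_mul, Complex.neg_re, Complex.ofReal_re] at h2
    exact h2
  have hge : ∀ᶠ ω in atTop, σ * (c ⬝ᵥ b) ≤ ((starRingEnd ℂ (l ω)) / l ω *
      (((c ⬝ᵥ A *ᵥ b : ℝ) : ℂ) + g (l ω))).re := by
    filter_upwards [hl.eventually (eventually_not_mem_spectrum (complexMatrix A))] with ω hω
    have hlre : (l ω).re = -σ := by simp [l]
    have hne : l ω ≠ 0 := by
      intro h
      have := congrArg Complex.re h
      rw [hlre] at this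
      simp at this
      exact hσ.ne' this
    have h1 := hf _ hω
    have h2 : (starRingEnd ℂ (l ω)) / l ω * (((c ⬝ᵥ A *ᵥ b : ℝ) : ℂ) + g (l ω)) =
        (Complex.normSq (l ω) : ℂ) * f (l ω) - ((c ⬝ᵥ b : ℝ) : ℂ) * starRingEnd ℂ (l ω) := by
      rw [← Complex.mul_conj]
      field_simp
      linear_combination -(starRingEnd ℂ (l ω)) * h1
    rw [h2, Complex.sub_re, Complex.re_ofReal_mul, Complex.re_ofReal_mul, Complex.conj_re, hlre]
    have := mul_nonneg (Complex.normSq_nonneg (l ω)) (hre _ hlre hω)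
    change 0 ≤ Complex.normSq (l ω) * (f (l ω)).re at this
    linarith
  have := ge_of_tendsto hlim hge
  have := mul_pos hσ h0
  linarith

/-- A transfer function with nonnegative real part on an open half plane containing the closed
right one has positive real part there, unless it vanishes. -/
theorem transfer_re_pos {M : Matrix ι ι ℂ} {b c : ι → ℂ} (h0 : c ⬝ᵥ b ≠ 0) {δ : ℝ}
    (hM : ∀ z ∈ spectrum ℂ M, z.re ≤ -δ)
    (hre : ∀ s : ℂ, -δ < s.re → 0 ≤ (sandwich c b 1 (resolvent M s)).re) {s : ℂ}
    (hs : -δ < s.re) : 0 < (sandwich c b 1 (resolvent M s)).re := by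
  set f : ℂ → ℂ := fun s => sandwich c b 1 (resolvent M s)
  set U : Set ℂ := {s | -δ < s.re}
  have hU : IsOpen U := isOpen_lt continuous_const Complex.continuous_re
  have hconv : Convex ℝ U := convex_halfSpace_re_gt _
  have hns : ∀ s ∈ U, s ∉ spectrum ℂ M := fun s hs h => (hM s h).not_gt hs
  have han : AnalyticOnNhd ℂ f U := by
    refine DifferentiableOn.analyticOnNhd (fun s hs => ?_) hU
    exact (differentiableAt_linear_resolvent _ (hns s hs)).differentiableWithinAt
  -- Open mapping: a nonconstant f takes U to an open subset of the closed half-plane, hence into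
  -- its interior. A constant f would be 0, against s f(s) → c·b ≠ 0.
  rcases han.is_constant_or_isOpen hconv.isPreconnected with ⟨w, hw⟩ | hopen
  · exfalso
    apply h0
    have h1 := (tendsto_linear_resolvent M (sandwich c b 1)).comp (tendsto_ray_cobounded one_ne_zero)
    have hev : ∀ᶠ t : ℝ in atTop, (t : ℂ) * 1 ∈ U := by
      filter_upwards [eventually_gt_atTop (-δ)] with t ht
      simpa [U] using ht
    have hw0 : w = 0 := by
      refine tendsto_nhds_unique (tendsto_const_nhds.congr' ?_) h1
      filter_upwards [hev] with t ht
      exact (hw _ ht).symm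
    have h2 := (tendsto_pow_mul_sandwich_resolvent c b M 0 (by simp)).comp
      (tendsto_ray_cobounded one_ne_zero)
    rw [pow_zero, one_mulVec] at h2
    refine tendsto_nhds_unique h2 (tendsto_const_nhds.congr' ?_)
    filter_upwards [hev] with t ht
    have := hw _ ht
    simp only [Function.comp_apply]
    change 0 = _ * f _
    rw [this, hw0, mul_zero]
  · have h1 := hopen U subset_rfl hU
    have hsub : f '' U ⊆ interior {z : ℂ | 0 ≤ z.re} := by
      refine h1.subset_interior_iff.2 ?_
      rintro _ ⟨z, hz, rfl⟩
      exact hre z hz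
    rw [Complex.interior_setOfPred_le_re] at hsub
    exact hsub ⟨s, hs, rfl⟩

/-- A nonzero transfer function of a Hurwitz matrix whose real part is nonnegative on a half plane
`re s > -ε` has a positive definite Kalman–Yakubovich–Popov solution. -/
theorem exists_kyp (A : Matrix ι ι ℝ) (b c : ι → ℝ) (hA : IsHurwitz A) {ε : ℝ} (hε : 0 < ε)
    (hre : ∀ s : ℂ, -ε < s.re → s ∉ spectrum ℂ (complexMatrix A) →
      0 ≤ (sandwich (complexVector c) (complexVector b) 1 (resolvent (complexMatrix A) s)).re)
    (hne : ∃ s ∉ spectrum ℂ (complexMatrix A),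
      sandwich (complexVector c) (complexVector b) 1 (resolvent (complexMatrix A) s) ≠ 0) :
    ∃ P : Matrix ι ι ℝ, Pᵀ = P ∧ P *ᵥ b = c ∧ Aᵀ * P + P * A ∈ negativeForms ι ∧
      ∀ x : ι → ℝ, x ≠ 0 → 0 < x ⬝ᵥ P *ᵥ x := by
  have h0 := highFrequencyGain_pos A b c (fun s hs => hre s (by linarith)) hne
  obtain ⟨η, hη, hηA⟩ : ∃ η : ℝ, 0 < η ∧ ∀ z ∈ spectrum ℂ (complexMatrix A), z.re ≤ -η := by
    rcases (spectrum ℂ (complexMatrix A)).eq_empty_or_nonempty with h | h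
    · exact ⟨1, one_pos, by simp [h]⟩
    · obtain ⟨z, hz, hmax⟩ := (finite_spectrum_matrix (complexMatrix A)).exists_maximalFor
        Complex.re _ h
      exact ⟨-z.re, neg_pos.2 (hA z hz), fun w hw => by
        rw [neg_neg]
        exact (le_total w.re z.re).elim id (hmax hw)⟩
  -- To the right of -δ there are no eigenvalues, so the inequality needs no exceptional points.
  set δ := min ε η with hδdef
  have hδ : 0 < δ := lt_min hε hη
  have hspec : ∀ z ∈ spectrum ℂ (complexMatrix A), z.re ≤ -δ := fun z hz =>
    (hηA z hz).trans (neg_le_neg (min_le_right _ _))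
  have hreδ : ∀ s : ℂ, -δ < s.re →
      0 ≤ (sandwich (complexVector c) (complexVector b) 1 (resolvent (complexMatrix A) s)).re :=
    fun s hs => hre s ((neg_le_neg (min_le_left _ _)).trans_lt hs) fun h => (hspec s h).not_gt hs
  have h1 := second_markov_neg A b c h0 (half_pos hδ)
    (fun s hs _ => hreδ s (by rw [hs]; linarith))
  obtain ⟨P, hP, hPb, hPA⟩ := exists_symmetric_kyp A b c h0 h1 (by
    intro ω x u hx hx0
    have hs : ((ω : ℂ) * Complex.I) ∉ spectrum ℂ (complexMatrix A) := fun h => by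
      have := hA _ h
      simp at this
    -- Then ū (c·x) = |u|² times the transfer function at iω.
    have hxu : x = u • (resolvent (complexMatrix A) ((ω : ℂ) * Complex.I) *ᵥ complexVector b) := by
      rw [← mulVec_smul, ← sub_eq_iff_eq_add'.2 hx.symm]
      have : ((ω : ℂ) * Complex.I) • x - complexMatrix A *ᵥ x =
          (((ω : ℂ) * Complex.I) • (1 : Matrix ι ι ℂ) - complexMatrix A) *ᵥ x := by
        rw [sub_mulVec, smul_mulVec, one_mulVec]
      rw [this, mulVec_mulVec, resolvent_mul_sub hs, one_mulVec]
    have hu : u ≠ 0 := by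
      rintro rfl
      rw [zero_smul] at hxu
      exact hx0 hxu
    have hpos := transfer_re_pos (b := complexVector b) (c := complexVector c)
      (by rw [complexVector_dotProduct]; exact_mod_cast h0.ne') hspec hreδ
      (s := (ω : ℂ) * Complex.I) (by simpa using hδ)
    rw [sandwich_apply, Matrix.one_mul] at hpos
    rw [hxu, dotProduct_smul, smul_eq_mul, ← mul_assoc, Complex.star_def,
      ← Complex.normSq_eq_conj_mul_self, Complex.re_ofReal_mul]
    exact mul_pos (Complex.normSq_pos.2 hu) hpos)
  exact ⟨P, hP, hPb, hPA, fun x hx => hA.pos_of_lyapunov hP hPA hx⟩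

end Scalar

/-! ### Quadratic Lyapunov functions -/

section Quadratic

open Filter Topology

variable {E : Type*} [NormedAddCommGroup E] [NormedSpace ℝ E]

-- z is bounded on the interval, and Φ(v,v) - Φ(w,w) = Φ(v-w,v) + Φ(w,v-w) makes the quadratic form
-- Lipschitz on bounded sets.
open AbsolutelyContinuousOnInterval in
theorem absolutelyContinuousOnInterval_quadratic (Φ : E →L[ℝ] E →L[ℝ] ℝ) {z : ℝ → E} {a b : ℝ}
    (hz : AbsolutelyContinuousOnInterval z a b) :
    AbsolutelyContinuousOnInterval (fun t => Φ (z t) (z t)) a b := by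
  obtain ⟨M, hM⟩ := hz.exists_bound
  have hz' := hz
  unfold AbsolutelyContinuousOnInterval at hz ⊢
  refine squeeze_zero' (Eventually.of_forall fun _ => Finset.sum_nonneg fun _ _ => dist_nonneg) ?_
    (by simpa using hz.const_mul (‖Φ‖ * M + ‖Φ‖ * M))
  rw [eventually_inf_principal]
  refine Eventually.of_forall fun I hI => ?_
  rw [Finset.mul_sum]
  refine Finset.sum_le_sum fun i hi => ?_
  have h1 := hM _ (hI.1 i hi).1
  have h2 := hM _ (hI.1 i hi).2
  set v := z (I.2 i).1
  set w := z (I.2 i).2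
  have h3 : Φ v v - Φ w w = Φ (v - w) v + Φ w (v - w) := by
    simp only [map_sub, _root_.sub_apply]
    ring
  rw [Real.dist_eq, ← Real.norm_eq_abs, h3, dist_eq_norm]
  have hΦ := norm_nonneg Φ
  calc ‖Φ (v - w) v + Φ w (v - w)‖ ≤ ‖Φ‖ * ‖v - w‖ * ‖v‖ + ‖Φ‖ * ‖w‖ * ‖v - w‖ :=
        (norm_add_le _ _).trans (add_le_add (Φ.le_opNorm₂ _ _) (Φ.le_opNorm₂ _ _))
    _ ≤ ‖Φ‖ * ‖v - w‖ * M + ‖Φ‖ * M * ‖v - w‖ := by gcongr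
    _ = (‖Φ‖ * M + ‖Φ‖ * M) * ‖v - w‖ := by ring

/-- A quadratic form with nonpositive derivative along a vector field does not increase along
the solutions. -/
theorem quadratic_le_of_isSolution (Φ : E →L[ℝ] E →L[ℝ] ℝ) {f : ℝ → E → E}
    (hf : ∀ t z, Φ (f t z) z + Φ z (f t z) ≤ 0) {t₀ t₁ : ℝ} {z : ℝ → E}
    (hz : IsSolution f t₀ t₁ z) {t : ℝ} (ht : t ∈ Icc t₀ t₁) :
    Φ (z t) (z t) ≤ Φ (z t₀) (z t₀) := by
  have hac : AbsolutelyContinuousOnInterval (fun t => Φ (z t) (z t)) t₀ t :=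
    (absolutelyContinuousOnInterval_quadratic Φ hz.1).mono (by
      rw [uIcc_of_le ht.1, uIcc_of_le (ht.1.trans ht.2)]
      exact Icc_subset_Icc_right ht.2)
  have hint := hac.integral_deriv_eq_sub
  have hneg : 0 ≤ ∫ s in t₀..t, -deriv (fun s => Φ (z s) (z s)) s := by
    refine intervalIntegral.integral_nonneg_of_ae_restrict ht.1 ?_
    rw [← Measure.restrict_congr_set Ioo_ae_eq_Icc]
    refine (ae_restrict_iff' measurableSet_Ioo).2 ?_
    filter_upwards [hz.2] with s hs hst
    have hd := hs ⟨hst.1, hst.2.trans_le ht.2⟩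
    have h1 := Φ.hasDerivAt_of_bilinear (fun _ => hd) (fun _ => hd)
    simp only [Pi.zero_apply, h1.deriv]
    linarith [hf s (z s)]
  rw [intervalIntegral.integral_neg, hint] at hneg
  linarith

/-- A positive definite quadratic form whose derivative along every vector field of a family is
nonpositive proves uniform stability in the large. -/
theorem uniformlyStableInTheLarge_of_quadratic [FiniteDimensional ℝ E] {I : Type*}
    {f : I → ℝ → E → E} (Φ : E →L[ℝ] E →L[ℝ] ℝ) (hΦ : ∀ z ≠ 0, 0 < Φ z z)
    (hf : ∀ i t z, Φ (f i t z) z + Φ z (f i t z) ≤ 0) (hf0 : ∀ i t, f i t 0 = 0) :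
    UniformlyStableInTheLarge f := by
  obtain ⟨m, hm, hmΦ⟩ : ∃ m : ℝ, 0 < m ∧ ∀ z, m * ‖z‖ ^ 2 ≤ Φ z z := by
    rcases (Metric.sphere (0 : E) 1).eq_empty_or_nonempty with h | h
    -- Without unit vectors the space is trivial.
    · refine ⟨1, one_pos, fun z => ?_⟩
      have hz : z = 0 := by
        by_contra hz
        have : ‖z‖⁻¹ • z ∈ Metric.sphere (0 : E) 1 := by
          rw [mem_sphere_iff_norm, sub_zero, norm_smul, norm_inv, norm_norm,
            inv_mul_cancel₀ (norm_ne_zero_iff.2 hz)]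
        rw [h] at this
        exact this
      simp [hz]
    · have hcont : Continuous fun z => Φ z z := Φ.continuous.clm_apply continuous_id
      have := FiniteDimensional.proper ℝ E
      obtain ⟨w, hw, hmin⟩ := (isCompact_sphere (0 : E) 1).exists_isMinOn h hcont.continuousOn
      have hw0 : w ≠ 0 := by
        rintro rfl
        simp at hw
      refine ⟨Φ w w, hΦ w hw0, fun z => ?_⟩
      by_cases hz : z = 0
      · simp [hz]
      have hz' : ‖z‖ ≠ 0 := norm_ne_zero_iff.2 hz
      have h1 : Φ w w ≤ Φ (‖z‖⁻¹ • z) (‖z‖⁻¹ • z) := hmin (by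
        rw [mem_sphere_iff_norm, sub_zero, norm_smul, norm_inv, norm_norm, inv_mul_cancel₀ hz'])
      rw [map_smul, map_smul, _root_.smul_apply, smul_eq_mul, smul_eq_mul] at h1
      calc Φ w w * ‖z‖ ^ 2 ≤ (‖z‖⁻¹ * (‖z‖⁻¹ * Φ z z)) * ‖z‖ ^ 2 := by gcongr
        _ = Φ z z := by field_simp
  have hMΦ : ∀ z, Φ z z ≤ (‖Φ‖ + 1) * ‖z‖ ^ 2 := fun z => by
    have := (le_abs_self _).trans (Φ.le_opNorm₂ z z)
    nlinarith [sq_nonneg ‖z‖]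
  set M := ‖Φ‖ + 1 with hMdef
  have hM : 0 < M := by positivity
  have key : ∀ (i : I) (t₀ t₁ : ℝ) (z : ℝ → E), IsSolution (f i) t₀ t₁ z → ∀ t ∈ Icc t₀ t₁,
      ‖z t‖ ≤ √(M / m) * ‖z t₀‖ := by
    intro i t₀ t₁ z hz t ht
    have h1 := (hmΦ (z t)).trans ((quadratic_le_of_isSolution Φ (hf i) hz ht).trans (hMΦ (z t₀)))
    refine (sq_le_sq₀ (norm_nonneg _) (by positivity)).1 ?_
    rw [mul_pow, Real.sq_sqrt (by positivity), div_mul_eq_mul_div, le_div_iff₀ hm]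
    linarith
  have hc : 0 < √(M / m) := Real.sqrt_pos.2 (by positivity)
  refine ⟨fun i t _ => hf0 i t, fun ε hε => ⟨ε / √(M / m), by positivity, ?_⟩,
    fun r hr => ⟨√(M / m) * r, by positivity, ?_⟩⟩
  · intro i t₀ t₁ z _ _ hz h0 t ht
    refine (key i t₀ t₁ z hz t ht).trans_lt ?_
    rwa [lt_div_iff₀ hc, mul_comm] at h0
  · intro i t₀ t₁ z _ _ hz h0 t ht
    exact (key i t₀ t₁ z hz t ht).trans_lt (mul_lt_mul_of_pos_left h0 hc)

end Quadratic

/-! ### The network -/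

section NetworkLyapunov

variable {m n : ℕ}

/-- The projection onto the states of agent `i`. -/
def blockProjection (n : ℕ) {m : ℕ} (i : Fin m) : Matrix (Fin n × Fin m) (Fin n × Fin m) ℝ :=
  Matrix.diagonal fun q => if q.2 = i then 1 else 0

theorem blockProjection_mul_netA (A : Fin m → Matrix (Fin n) (Fin n) ℝ) (i : Fin m) :
    blockProjection n i * netA A = netA A * blockProjection n i := by
  ext ⟨a, j⟩ ⟨b, l⟩
  rw [blockProjection, diagonal_mul, mul_diagonal, netA, blockDiagonal_apply]
  by_cases h : j = l
  · subst h; simp [mul_comm]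
  · simp [h]

theorem blockProjection_mulVec_apply (i : Fin m) (x : Fin n × Fin m → ℝ) (q : Fin n × Fin m) :
    (blockProjection n i *ᵥ x) q = if q.2 = i then x q else 0 := by
  rw [blockProjection, mulVec_diagonal, ite_mul, one_mul, zero_mul]

theorem blockProjection_mulVec_netB (B : Fin m → Fin n → ℝ) (i : Fin m) (u : Fin m → ℝ) :
    blockProjection n i *ᵥ netB B *ᵥ u = u i • fun q => netB B q i := by
  ext ⟨a, j⟩
  rw [blockProjection_mulVec_apply]
  simp only [netB, mulVec, dotProduct, of_apply, Pi.smul_apply, smul_eq_mul, ite_mul, zero_mul,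
    Finset.sum_ite_eq, Finset.mem_univ, if_true]
  by_cases h : j = i
  · subst h; simp [mul_comm]
  · simp [h]

theorem netC_dotProduct_blockProjection (C : Fin m → Fin n → ℝ) (i : Fin m)
    (x : Fin n × Fin m → ℝ) : netC C i ⬝ᵥ blockProjection n i *ᵥ x = (netC C *ᵥ x) i := by
  rw [dotProduct, mulVec, dotProduct]
  refine Finset.sum_congr rfl fun q _ => ?_
  rw [blockProjection_mulVec_apply]
  simp only [netC, of_apply]
  split_ifs <;> simp

/-- A common quadratic storage function for the network. -/
theorem exists_network_storage (A : Fin m → Matrix (Fin n) (Fin n) ℝ) (B C : Fin m → Fin n → ℝ)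
    (hstab : IsStabilizable (netA A) (netB B)) (hdet : IsDetectable (netA A) (netC C))
    (hne : ∀ i, ∃ s : ℂ, transferFunction (netA A) (netB B) (netC C) s i i ≠ 0)
    (hspr : IsStrictlyPositiveReal (transferFunction (netA A) (netB B) (netC C))) :
    ∃ P : Matrix (Fin n × Fin m) (Fin n × Fin m) ℝ, Pᵀ = P ∧ (∀ x, x ≠ 0 → 0 < x ⬝ᵥ P *ᵥ x) ∧
      (∀ x, x ⬝ᵥ P *ᵥ netA A *ᵥ x ≤ 0) ∧
      ∀ x u, x ⬝ᵥ P *ᵥ netB B *ᵥ u = netC C *ᵥ x ⬝ᵥ u := by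
  have hA := isHurwitz_of_isStrictlyPositiveReal hstab hdet hspr
  obtain ⟨ε, hε, G, ⟨S, hS, hGW⟩, hG, -, hpos⟩ := hspr
  have hW : ∀ s i, transferFunction (netA A) (netB B) (netC C) s i i =
      sandwich (complexVector (netC C i)) (complexVector fun q => netB B q i) 1
        (resolvent (complexMatrix (netA A)) s) := by
    intro s i
    rw [transferFunction, inv_eq_resolvent, Matrix.mul_assoc, sandwich_apply, Matrix.one_mul]
    rfl
  have hre : ∀ (i : Fin m) (s : ℂ), -ε < s.re → s ∉ spectrum ℂ (complexMatrix (netA A)) →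
      0 ≤ (sandwich (complexVector (netC C i)) (complexVector fun q => netB B q i) 1
        (resolvent (complexMatrix (netA A)) s)).re := by
    intro i s hs hsA
    set f : ℂ → ℂ := fun s => sandwich (complexVector (netC C i))
      (complexVector fun q => netB B q i) 1 (resolvent (complexMatrix (netA A)) s)
    have hcont : ContinuousAt f s := (differentiableAt_linear_resolvent _ hsA).continuousAt
    have hlim : Filter.Tendsto (fun s => (f s).re) (nhdsWithin s {s}ᶜ) (nhds (f s).re) :=
      ((Complex.continuous_re.tendsto _).comp hcont).mono_left nhdsWithin_le_nhds
    -- At s itself the entry may differ from G; continuity carries the inequality over from nearby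
    -- points outside the shifted S.
    refine ge_of_tendsto hlim ?_
    have hSfin : ((fun s : ℂ => s + (ε : ℂ)) ⁻¹' S).Finite :=
      hS.preimage (add_left_injective _).injOn
    have h1 : (((fun s : ℂ => s + (ε : ℂ)) ⁻¹' S) \ {s})ᶜ ∈ nhds s :=
      (hSfin.subset sdiff_subset).isClosed.isOpen_compl.mem_nhds (by simp)
    have h2 : {s : ℂ | -ε < s.re} ∈ nhds s :=
      (isOpen_lt continuous_const Complex.continuous_re).mem_nhds hs
    filter_upwards [mem_nhdsWithin_of_mem_nhds h1, mem_nhdsWithin_of_mem_nhds h2,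
      self_mem_nhdsWithin] with w hw1 hw2 hw3
    have hwS : w + ε ∉ S := fun h => hw1 ⟨h, hw3⟩
    have hwre : 0 < (w + ε).re := by
      simp only [Complex.add_re, Complex.ofReal_re]
      linarith [show -ε < w.re from hw2]
    have h3 := (hpos _ hwre).diag_nonneg (i := i)
    have h4 := hGW _ hwre hwS
    simp only [add_sub_cancel_right] at h4
    rw [Matrix.add_apply, conjTranspose_apply, h4, hW, Complex.star_def, Complex.add_conj] at h3
    have h5 : 0 ≤ 2 * (f w).re := by exact_mod_cast h3
    linarith
  have hex : ∀ i, ∃ P : Matrix (Fin n × Fin m) (Fin n × Fin m) ℝ, Pᵀ = P ∧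
      P *ᵥ (fun q => netB B q i) = netC C i ∧
      (netA A)ᵀ * P + P * netA A ∈ negativeForms (Fin n × Fin m) ∧
      ∀ x, x ≠ 0 → 0 < x ⬝ᵥ P *ᵥ x := by
    intro i
    refine exists_kyp (netA A) _ _ hA hε (hre i) ?_
    obtain ⟨s, hs⟩ := hne i
    rw [hW] at hs
    -- At an eigenvalue the inverse has the default value 0, so a point with nonzero value is not an
    -- eigenvalue.
    refine ⟨s, fun hmem => hs ?_, hs⟩
    have : resolvent (complexMatrix (netA A)) s = 0 := by
      rw [resolvent, Ring.inverse_non_unit]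
      exact fun h => spectrum.mem_iff.1 hmem h
    rw [this, map_zero]
  choose P hP hPb hPA hPpos using hex
  have hform : ∀ x y : Fin n × Fin m → ℝ,
      x ⬝ᵥ (∑ i, blockProjection n i * P i * blockProjection n i) *ᵥ y =
        ∑ i, (blockProjection n i *ᵥ x) ⬝ᵥ P i *ᵥ blockProjection n i *ᵥ y := by
    intro x y
    rw [sum_mulVec, dotProduct_sum]
    refine Finset.sum_congr rfl fun i _ => ?_
    rw [← mulVec_mulVec, ← mulVec_mulVec, dotProduct_mulVec, ← mulVec_transpose, blockProjection,
      diagonal_transpose]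
  -- P_i lives on the whole network state; only its i-th diagonal block is kept, which is enough
  -- because b_i and c_i are supported there.
  refine ⟨∑ i, blockProjection n i * P i * blockProjection n i, ?_, fun x hx => ?_, fun x => ?_,
    fun x u => ?_⟩
  · rw [transpose_sum]
    refine Finset.sum_congr rfl fun i _ => ?_
    rw [transpose_mul, transpose_mul, hP, blockProjection, diagonal_transpose, Matrix.mul_assoc]
  · rw [hform]
    have hnonneg : ∀ i ∈ Finset.univ,
        0 ≤ (blockProjection n i *ᵥ x) ⬝ᵥ P i *ᵥ blockProjection n i *ᵥ x := by
      intro i _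
      by_cases h : blockProjection n i *ᵥ x = 0
      · simp [h]
      · exact (hPpos i _ h).le
    obtain ⟨⟨a, i⟩, hai⟩ := Function.ne_iff.1 hx
    refine Finset.sum_pos' hnonneg ⟨i, Finset.mem_univ i, hPpos i _ fun h => hai ?_⟩
    simpa [blockProjection, mulVec_diagonal] using congrFun h (a, i)
  · rw [hform]
    refine Finset.sum_nonpos fun i _ => ?_
    rw [mulVec_mulVec _ _ (netA A), blockProjection_mul_netA, ← mulVec_mulVec]
    set y := blockProjection n i *ᵥ x
    by_cases hy : y = 0
    · simp [hy]
    have h1 := hPA i y hy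
    rw [add_mulVec, dotProduct_add, ← mulVec_mulVec, ← mulVec_mulVec, dotProduct_mulVec y (netA A)ᵀ,
      vecMul_transpose, dotProduct_mulVec (netA A *ᵥ y), ← mulVec_transpose, hP,
      dotProduct_comm (P i *ᵥ netA A *ᵥ y)] at h1
    linarith
  · rw [hform, dotProduct]
    refine Finset.sum_congr rfl fun i _ => ?_
    rw [blockProjection_mulVec_netB, mulVec_smul, hPb, dotProduct_smul, dotProduct_comm,
      netC_dotProduct_blockProjection, smul_eq_mul, mul_comm]

end NetworkLyapunov

end NetAdapt

end

theorem lemma1 {m n p : ℕ}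
    (A : Fin m → Matrix (Fin n) (Fin n) ℝ) (B C : Fin m → Fin n → ℝ) (k : Fin m → ℝ)
    (hk : ∀ i, k i ≠ 0)
    (hstab : NetAdapt.IsStabilizable (NetAdapt.netA A) (NetAdapt.netB B))
    (hdet : NetAdapt.IsDetectable (NetAdapt.netA A) (NetAdapt.netC C))
    (hne : ∀ i, ∃ s : ℂ,
      NetAdapt.transferFunction (NetAdapt.netA A) (NetAdapt.netB B) (NetAdapt.netC C) s i i ≠ 0)
    (hspr : NetAdapt.IsStrictlyPositiveReal
      (NetAdapt.transferFunction (NetAdapt.netA A) (NetAdapt.netB B) (NetAdapt.netC C))) :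
    NetAdapt.UniformlyStableInTheLarge
      (fun η : ℝ → Fin p × Fin m → ℝ => NetAdapt.closedLoop A B C k η) := by
  obtain ⟨P, hP, hPpos, hPA, hPB⟩ := NetAdapt.exists_network_storage A B C hstab hdet hne hspr
  -- The weight |k_j|⁻¹ offsets the factor sign(k_j) k_j = |k_j| produced by the adaptive law.
  have hbil : IsBilinearMap ℝ fun z w : NetAdapt.State m n p =>
      z.1 ⬝ᵥ P *ᵥ w.1 + ∑ j, |k j|⁻¹ * ∑ q, z.2 q j * w.2 q j :=
    { add_left := fun z z' w => by
        simp only [Prod.fst_add, Prod.snd_add, Pi.add_apply, add_dotProduct, add_mul,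
          Finset.sum_add_distrib, mul_add]
        ring
      smul_left := fun r z w => by
        simp only [Prod.smul_fst, Prod.smul_snd, Pi.smul_apply, smul_dotProduct, smul_eq_mul,
          mul_add, Finset.mul_sum, mul_assoc, mul_left_comm r]
      add_right := fun z w w' => by
        simp only [Prod.fst_add, Prod.snd_add, Pi.add_apply, mulVec_add, dotProduct_add, mul_add,
          Finset.sum_add_distrib]
        ring
      smul_right := fun r z w => by
        simp only [Prod.smul_fst, Prod.smul_snd, Pi.smul_apply, mulVec_smul, dotProduct_smul,
          smul_eq_mul, mul_add, Finset.mul_sum, mul_left_comm r] }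
  refine NetAdapt.uniformlyStableInTheLarge_of_quadratic hbil.toContinuousBilinearMap ?_ ?_ ?_
  · intro z hz
    change 0 < z.1 ⬝ᵥ P *ᵥ z.1 + ∑ j, |k j|⁻¹ * ∑ q, z.2 q j * z.2 q j
    have hsum : ∀ j, 0 ≤ |k j|⁻¹ * ∑ q, z.2 q j * z.2 q j := fun j =>
      mul_nonneg (inv_nonneg.2 (abs_nonneg _)) (Finset.sum_nonneg fun q _ => mul_self_nonneg _)
    by_cases hx : z.1 = 0
    · have hΘ : z.2 ≠ 0 := fun h => hz (Prod.ext hx h)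
      obtain ⟨q, hq⟩ := Function.ne_iff.1 hΘ
      obtain ⟨j, hj⟩ := Function.ne_iff.1 hq
      rw [hx, zero_dotProduct, zero_add]
      refine Finset.sum_pos' (fun j _ => hsum j) ⟨j, Finset.mem_univ j, ?_⟩
      refine mul_pos (inv_pos.2 (abs_pos.2 (hk j))) ?_
      exact Finset.sum_pos' (fun q _ => mul_self_nonneg _)
        ⟨q, Finset.mem_univ q, mul_self_pos.2 hj⟩
    · exact add_pos_of_pos_of_nonneg (hPpos _ hx) (Finset.sum_nonneg fun j _ => hsum j)
  · intro η t z
    set u := NetAdapt.feedbackInput (Matrix.of z.2) (η t) with hu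
    set f := NetAdapt.closedLoop A B C k η t z with hf
    change f.1 ⬝ᵥ P *ᵥ z.1 + ∑ j, |k j|⁻¹ * ∑ q, f.2 q j * z.2 q j +
      (z.1 ⬝ᵥ P *ᵥ f.1 + ∑ j, |k j|⁻¹ * ∑ q, z.2 q j * f.2 q j) ≤ 0
    have hsym : f.1 ⬝ᵥ P *ᵥ z.1 = z.1 ⬝ᵥ P *ᵥ f.1 := by
      rw [dotProduct_mulVec, ← mulVec_transpose, hP, dotProduct_comm]
    have h1 : z.1 ⬝ᵥ P *ᵥ f.1 = z.1 ⬝ᵥ P *ᵥ NetAdapt.netA A *ᵥ z.1 +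
        NetAdapt.netC C *ᵥ z.1 ⬝ᵥ u := by
      rw [← hPB, ← dotProduct_add, ← mulVec_add]
      rfl
    have hfΘ : ∀ q j, f.2 q j = -(|k j| * (NetAdapt.netC C *ᵥ z.1) j * η t q) := by
      intro q j
      have : f.2 q j = -(Real.sign (k j) * ((k j * (NetAdapt.netC C *ᵥ z.1) j) * η t q)) := by
        change NetAdapt.adaptiveLaw k (NetAdapt.output C k z.1) (η t) q j = _
        rw [NetAdapt.adaptiveLaw, transpose_apply, Matrix.neg_apply, diagonal_mul, vecMulVec_apply,
          NetAdapt.output, ← mulVec_mulVec, mulVec_diagonal]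
      have habs : |k j| = Real.sign (k j) * k j := by
        rcases (hk j).lt_or_gt with h | h
        · rw [abs_of_neg h, Real.sign_of_neg h, neg_one_mul]
        · rw [abs_of_pos h, Real.sign_of_pos h, one_mul]
      rw [this, habs]
      ring
    -- This cancels the coupling term of `h1`.
    have h2 : ∑ j, |k j|⁻¹ * ∑ q, z.2 q j * f.2 q j = -(NetAdapt.netC C *ᵥ z.1 ⬝ᵥ u) := by
      rw [dotProduct, ← Finset.sum_neg_distrib]
      refine Finset.sum_congr rfl fun j _ => ?_
      have hkj : |k j| ≠ 0 := abs_ne_zero.2 (hk j)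
      have huj : u j = ∑ q, z.2 q j * η t q := rfl
      rw [huj, Finset.mul_sum, Finset.mul_sum, ← Finset.sum_neg_distrib]
      refine Finset.sum_congr rfl fun q _ => ?_
      rw [hfΘ]
      field_simp
    have h3 : ∑ j, |k j|⁻¹ * ∑ q, f.2 q j * z.2 q j = ∑ j, |k j|⁻¹ * ∑ q, z.2 q j * f.2 q j := by
      simp only [mul_comm]
    rw [hsym, h3, h2, h1]
    linarith [hPA z.1]
  · intro η t
    refine Prod.ext ?_ ?_
    · ext q
      simp [NetAdapt.closedLoop, NetAdapt.feedbackInput]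
    · funext q j
      simp [NetAdapt.closedLoop, NetAdapt.adaptiveLaw, NetAdapt.output]
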